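/- Let $d\ge 4$ and let $(M,g)$ be a $d$-dimensional spacetime: a smooth Hausdorff $d$-manifold with a smooth metric of signature $(-,+,\dots,+)$, Levi-Civita connection $\nabla$, Ricci tensor $R_{\mu\nu}$ and Weyl tensor $C_{\mu\nu\rho\sigma}$. A null vector field is a nowhere vanishing smooth vector field $\ell$ with $g(\ell,\ell)=0$. A null frame containing $\ell$ at a point is a basis $e_0=\ell,\ e_1=n,\ e_i=m_i$ $(2\le i\le d-1)$ of the tangent space such that $\ell\cdot n=1$, $m_i\cdot m_j=\delta_{ij}$ and all other inner products vanish. The component $C_{abcd}=C(e_a,e_b,e_c,e_d)$ has boost weight equal to the number of its indices equal to $0$ minus the number equal to $1$. The field $\ell$ is a Weyl-aligned null direction (WAND) if all Weyl components of boost weight $+2$ vanish everywhere in null frames containing $\ell$, and a multiple WAND if all those of boost weights $+2$ and $+1$ vanish everywhere; $(M,g)$ is algebraically special if it admits a multiple WAND. The field $\ell$ is (tangent to) a null geodesic congruence if $\nabla_\ell\ell$ is everywhere proportional to $\ell$; its expansion, shear and twist are the trace, the tracefree symmetric part and the antisymmetric part of the matrix $\rho_{ij}=m_i^\mu m_j^\nu\nabla_\nu\ell_\mu$.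 A Kundt spacetime is one that admits a null geodesic congruence with vanishing expansion, shear and twist. **Theorem.** Let $\ell$ be a non-expanding, non-twisting, non-shearing null geodesic congruence in a Kundt spacetime $(M,g)$. Then $\ell$ is a WAND. If, in addition, the vector field $R(\ell)^\mu=R^\mu{}_\nu\ell^\nu$ is everywhere null, i.e. $g(R(\ell),R(\ell))=0$ (with $R(\ell)=0$ allowed), then $\ell$ is a multiple WAND, and hence $(M,g)$ is algebraically special. -/

import Mathlib

open Bundle
open scoped Manifold ContDiff

namespace Kundt

/-- A smooth Lorentzian metric, of signature `(-,+,…,+)`, on a `d`-dimensional manifold. -/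
structure LorentzMetric (d : ℕ) (M : Type*) [TopologicalSpace M]
    [ChartedSpace (EuclideanSpace ℝ (Fin d)) M] [IsManifold (𝓡 d) ∞ M] where
  /-- the bilinear form on each tangent space -/
  val : ∀ x : M, TangentSpace (𝓡 d) x →L[ℝ] TangentSpace (𝓡 d) x →L[ℝ] ℝ
  symm : ∀ (x : M) (v w : TangentSpace (𝓡 d) x), val x v w = val x w v
  contMDiff : ContMDiff (𝓡 d)
    ((𝓡 d).prod 𝓘(ℝ, EuclideanSpace ℝ (Fin d) →L[ℝ] EuclideanSpace ℝ (Fin d) →L[ℝ] ℝ)) ∞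
    (fun x ↦ TotalSpace.mk' (EuclideanSpace ℝ (Fin d) →L[ℝ] EuclideanSpace ℝ (Fin d) →L[ℝ] ℝ)
      (E := fun x : M ↦ TangentSpace (𝓡 d) x →L[ℝ] TangentSpace (𝓡 d) x →L[ℝ] ℝ) x (val x))
  signature : ∀ x : M, ∃ b : Module.Basis (Fin d) ℝ (TangentSpace (𝓡 d) x), ∀ i j : Fin d,
    val x (b i) (b j) = if i = j then (if (i : ℕ) = 0 then -1 else 1) else 0

section

variable {d : ℕ} {M : Type*} [TopologicalSpace M] [ChartedSpace (EuclideanSpace ℝ (Fin d)) M]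

/-- A (not necessarily smooth) vector field. -/
abbrev VField (d : ℕ) (M : Type*) [TopologicalSpace M]
    [ChartedSpace (EuclideanSpace ℝ (Fin d)) M] : Type _ :=
  ∀ x : M, TangentSpace (𝓡 d) x

variable [IsManifold (𝓡 d) ∞ M]

/-- Smoothness of a vector field. -/
def IsSmoothField (X : VField d M) : Prop :=
  ContMDiff (𝓡 d) (𝓡 d).tangent ∞
    (fun x ↦ (⟨x, X x⟩ : TangentBundle (𝓡 d) M))

/-- A vector field with value `v` at `x`, and with constant components near `x` in the preferred
chart at `x`. -/
noncomputable def ext {x : M} (v : TangentSpace (𝓡 d) x) : VField d M :=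
  FiberBundle.extend (EuclideanSpace ℝ (Fin d)) v

/-- The coordinate basis vector `∂ᵢ` at `x`, in the preferred chart at `x`. -/
noncomputable def coordVec (x : M) (i : Fin d) : TangentSpace (𝓡 d) x :=
  (EuclideanSpace.single i (1 : ℝ) : EuclideanSpace ℝ (Fin d))

/-- The index of a null frame: `0` for the vector `ℓ`, `1` for the vector `n`, and a spatial
index, ranging over `d - 2` values, for the vectors `mᵢ`. -/
inductive FrameIndex (d : ℕ) : Type
  | zero : FrameIndex d
  | one : FrameIndex d
  | space : Fin (d - 2) → FrameIndex d

namespace FrameIndex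

/-- The inner products of a null frame. -/
def eta {d : ℕ} : FrameIndex d → FrameIndex d → ℝ
  | zero, one => 1
  | one, zero => 1
  | space i, space j => if i = j then 1 else 0
  | _, _ => 0

/-- The boost weight that a lower frame index contributes to a tensor component. -/
def boostWeight {d : ℕ} : FrameIndex d → ℤ
  | zero => 1
  | one => -1
  | space _ => 0

end FrameIndex

namespace LorentzMetric

variable (g : LorentzMetric d M)

/-- The components `g^{ij}` of the inverse metric at `x`, in the basis `coordVec x`. -/
noncomputable def inv (x : M) : Matrix (Fin d) (Fin d) ℝ :=
  (Matrix.of fun i j ↦ g.val x (coordVec x i) (coordVec x j))⁻¹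

/-- Raising an index: the vector `φ^j = g^{ij} φ_i` dual to a covector `φ` at `x`. -/
noncomputable def sharp (x : M) (φ : TangentSpace (𝓡 d) x → ℝ) : TangentSpace (𝓡 d) x :=
  ∑ i, ∑ j, (g.inv x i j * φ (coordVec x i)) • coordVec x j

/-- The function `g(X, Y)`. -/
noncomputable def pair (X Y : VField d M) (y : M) : ℝ := g.val y (X y) (Y y)

/-- The right-hand side of the Koszul formula for `g(∇_X Y, Z)`. -/
noncomputable def koszul (X Y Z : VField d M) (x : M) : ℝ :=
  (mvfderiv (𝓡 d) (g.pair Y Z) x (X x) + mvfderiv (𝓡 d) (g.pair Z X) x (Y x)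
    - mvfderiv (𝓡 d) (g.pair X Y) x (Z x)
    + g.val x (VectorField.mlieBracket (𝓡 d) X Y x) (Z x)
    - g.val x (VectorField.mlieBracket (𝓡 d) Y Z x) (X x)
    - g.val x (VectorField.mlieBracket (𝓡 d) X Z x) (Y x)) / 2

/-- The Levi-Civita covariant derivative `∇_v Y` of `Y` at `x`, for a tangent vector `v` at `x`,
given by the Koszul formula. -/
noncomputable def nabla (Y : VField d M) (x : M) (v : TangentSpace (𝓡 d) x) :
    TangentSpace (𝓡 d) x :=
  g.sharp x fun z ↦ g.koszul (ext v) Y (ext z) x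

/-- The curvature operator `R(X, Y) Z = ∇_X ∇_Y Z - ∇_Y ∇_X Z - ∇_{[X, Y]} Z` on fields. -/
noncomputable def curv (X Y Z : VField d M) (x : M) : TangentSpace (𝓡 d) x :=
  g.nabla (fun y ↦ g.nabla Z y (Y y)) x (X x) - g.nabla (fun y ↦ g.nabla Z y (X y)) x (Y x)
    - g.nabla Z x (VectorField.mlieBracket (𝓡 d) X Y x)

/-- The Riemann tensor `R_{μνρσ} u^μ v^ν w^ρ z^σ` at `x`, with the sign convention
`[∇_μ, ∇_ν] V_ρ = R_{μνρσ} V^σ`. -/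
noncomputable def riem (x : M) (u v w z : TangentSpace (𝓡 d) x) : ℝ :=
  g.val x (g.curv (ext u) (ext v) (ext z) x) w

/-- The Ricci tensor `R_{μν} = g^{ρσ} R_{μρνσ}`. -/
noncomputable def ric (x : M) (u v : TangentSpace (𝓡 d) x) : ℝ :=
  ∑ i, ∑ j, g.inv x i j * g.riem x u (coordVec x i) v (coordVec x j)

/-- The scalar curvature `R = g^{μν} R_{μν}`. -/
noncomputable def scal (x : M) : ℝ :=
  ∑ i, ∑ j, g.inv x i j * g.ric x (coordVec x i) (coordVec x j)

/-- The vector `R(v)^μ = R^μ_ν v^ν`. -/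
noncomputable def ricVec (x : M) (v : TangentSpace (𝓡 d) x) : TangentSpace (𝓡 d) x :=
  g.sharp x fun z ↦ g.ric x z v

/-- The Weyl tensor `C_{μνρσ} u^μ v^ν w^ρ z^σ`, the totally traceless part of the Riemann
tensor. -/
noncomputable def weyl (x : M) (u v w z : TangentSpace (𝓡 d) x) : ℝ :=
  g.riem x u v w z
    - 1 / ((d : ℝ) - 2) *
      (g.ric x u w * g.val x v z - g.ric x u z * g.val x v w
        - g.ric x v w * g.val x u z + g.ric x v z * g.val x u w)
    + g.scal x / (((d : ℝ) - 1) * ((d : ℝ) - 2)) *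
      (g.val x u w * g.val x v z - g.val x u z * g.val x v w)

/-- A null frame `{ℓ, n, mᵢ}` of the tangent space at `x`. -/
structure NullFrame (x : M) where
  /-- the vectors of the frame -/
  vec : FrameIndex d → TangentSpace (𝓡 d) x
  inner_eq : ∀ a b, g.val x (vec a) (vec b) = FrameIndex.eta a b

/-- `ℓ` is a null vector field: nowhere zero and of zero norm. -/
def IsNullField (ℓ : VField d M) : Prop :=
  ∀ x, ℓ x ≠ 0 ∧ g.val x (ℓ x) (ℓ x) = 0

/-- The integral curves of `ℓ` are geodesics, not necessarily affinely parametrized. -/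
def IsGeodesicField (ℓ : VField d M) : Prop :=
  ∀ x, ∃ c : ℝ, g.nabla ℓ x (ℓ x) = c • ℓ x

variable {g}

/-- The optical matrix `ρ_{ij} = m_i^μ m_j^ν ∇_ν ℓ_μ` of `ℓ` in a null frame. -/
noncomputable def opticalMatrix (ℓ : VField d M) {x : M} (e : g.NullFrame x) :
    Matrix (Fin (d - 2)) (Fin (d - 2)) ℝ :=
  Matrix.of fun i j ↦ g.val x (g.nabla ℓ x (e.vec (.space j))) (e.vec (.space i))

/-- The expansion: the trace of the optical matrix. -/
noncomputable def expansion (ℓ : VField d M) {x : M} (e : g.NullFrame x) : ℝ :=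
  (opticalMatrix ℓ e).trace

/-- The shear: the tracefree symmetric part of the optical matrix. -/
noncomputable def shear (ℓ : VField d M) {x : M} (e : g.NullFrame x) :
    Matrix (Fin (d - 2)) (Fin (d - 2)) ℝ :=
  (1 / 2 : ℝ) • (opticalMatrix ℓ e + (opticalMatrix ℓ e).transpose)
    - (expansion ℓ e / ((d : ℝ) - 2)) • (1 : Matrix (Fin (d - 2)) (Fin (d - 2)) ℝ)

/-- The twist: the antisymmetric part of the optical matrix. -/
noncomputable def twist (ℓ : VField d M) {x : M} (e : g.NullFrame x) :
    Matrix (Fin (d - 2)) (Fin (d - 2)) ℝ :=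
  (1 / 2 : ℝ) • (opticalMatrix ℓ e - (opticalMatrix ℓ e).transpose)

variable (g)

/-- `ℓ` is (tangent to) a null geodesic congruence with vanishing expansion, shear and twist. -/
structure IsKundtCongruence (ℓ : VField d M) : Prop where
  smooth : IsSmoothField ℓ
  null : g.IsNullField ℓ
  geodesic : g.IsGeodesicField ℓ
  nonexpanding : ∀ (x : M) (e : g.NullFrame x), e.vec .zero = ℓ x → expansion ℓ e = 0
  nonshearing : ∀ (x : M) (e : g.NullFrame x), e.vec .zero = ℓ x → shear ℓ e = 0
  nontwisting : ∀ (x : M) (e : g.NullFrame x), e.vec .zero = ℓ x → twist ℓ e = 0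

/-- All components of boost weight `b` of the Weyl tensor vanish everywhere, in every null frame
whose first vector is `ℓ`. -/
def WeylBoostVanishes (ℓ : VField d M) (b : ℤ) : Prop :=
  ∀ (x : M) (e : g.NullFrame x), e.vec .zero = ℓ x → ∀ i j k l : FrameIndex d,
    i.boostWeight + j.boostWeight + k.boostWeight + l.boostWeight = b →
      g.weyl x (e.vec i) (e.vec j) (e.vec k) (e.vec l) = 0

/-- `ℓ` is a Weyl-aligned null direction (WAND). -/
def IsWAND (ℓ : VField d M) : Prop :=
  IsSmoothField ℓ ∧ g.IsNullField ℓ ∧ g.WeylBoostVanishes ℓ 2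

/-- `ℓ` is a multiple WAND. -/
def IsMultipleWAND (ℓ : VField d M) : Prop :=
  IsSmoothField ℓ ∧ g.IsNullField ℓ ∧ g.WeylBoostVanishes ℓ 2 ∧ g.WeylBoostVanishes ℓ 1

/-- The spacetime admits a multiple WAND. -/
def IsAlgebraicallySpecial : Prop :=
  ∃ ℓ : VField d M, g.IsMultipleWAND ℓ

end LorentzMetric

end

end Kundt

/-! The vanishing of expansion, shear and twist, together with geodesy and nullity of `ℓ`, says that
g(∇_a ℓ, b) = 0 whenever a and b are orthogonal to `ℓ` (`val_nabla_eq_zero`). Thus ∇_v ℓ is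
proportional to `ℓ` for v in ℓ^⊥, and the distribution ℓ^⊥ is involutive and closed under covariant
differentiation along itself. Differentiating the identity g(∇_V ℓ, W) = 0 once more along ℓ^⊥ kills
every curvature component R(u, v, w, ℓ) with u, v, w in ℓ^⊥ (`riem_eq_zero`).

In a null frame this gives R_{0i0j} = 0 and R_{0ijk} = 0, and tracing gives Ric_{00} = 0; the Weyl
components of boost weight +2 therefore vanish. In boost weight +1 the only surviving Riemann
component is R_{010i}, equal to Ric_{0i} up to sign. As Ric_{00} = 0, the norm of R(ℓ) is the sum of
squares of the Ric_{0i}, so nullity of R(ℓ) forces each of them to vanish, and the Weyl components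
of boost weight +1 with them (`weyl_one`).

The rest establishes the classical facts about the connection given by the Koszul formula: metric
compatibility, zero torsion, the symmetries and tensoriality of the curvature, and traces in null
frames. -/

namespace Kundt

open Filter Topology VectorField
open scoped Matrix

/-! ### Calculus of smooth functions, vector fields and Lie brackets. -/

section

variable {d : ℕ} {M : Type*} [TopologicalSpace M] [ChartedSpace (EuclideanSpace ℝ (Fin d)) M]

/-- Smoothness of a real function at a point. -/
abbrev SmoothFunAt (d : ℕ) {M : Type*} [TopologicalSpace M]
    [ChartedSpace (EuclideanSpace ℝ (Fin d)) M] (f : M → ℝ) (x : M) : Prop :=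
  ContMDiffAt (𝓡 d) 𝓘(ℝ) ∞ f x

/-- Differentiability of a real function at a point. -/
abbrev DiffFunAt (d : ℕ) {M : Type*} [TopologicalSpace M]
    [ChartedSpace (EuclideanSpace ℝ (Fin d)) M] (f : M → ℝ) (x : M) : Prop :=
  MDifferentiableAt (𝓡 d) 𝓘(ℝ) f x

/-- The derivative of a function along a tangent vector. -/
noncomputable abbrev dir (f : M → ℝ) (x : M) (v : TangentSpace (𝓡 d) x) : ℝ :=
  mvfderiv (𝓡 d) f x v

theorem SmoothFunAt.diffFunAt {f : M → ℝ} {x : M} (h : SmoothFunAt d f x) : DiffFunAt d f x :=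
  h.mdifferentiableAt (by simp)

theorem dir_congr {f h : M → ℝ} {x : M} (e : f =ᶠ[𝓝 x] h) (v : TangentSpace (𝓡 d) x) :
    dir f x v = dir h x v := by
  simp only [dir, mvfderiv, e.mfderiv_eq]
  rw [e.self_of_nhds]

theorem dir_mul {f h : M → ℝ} {x : M} (hf : DiffFunAt d f x) (hh : DiffFunAt d h x)
    (v : TangentSpace (𝓡 d) x) :
    dir (fun y ↦ f y * h y) x v = f x * dir h x v + h x * dir f x v := by
  have := congrArg (fun φ ↦ φ v) (mvfderiv_mul hf hh)
  simp only [add_apply, smul_apply, smul_eq_mul] at this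
  exact this

theorem dir_add {f h : M → ℝ} {x : M} (hf : DiffFunAt d f x) (hh : DiffFunAt d h x)
    (v : TangentSpace (𝓡 d) x) :
    dir (fun y ↦ f y + h y) x v = dir f x v + dir h x v :=
  congrArg (fun φ ↦ φ v) (mvfderiv_add hf hh)

theorem dir_const {x : M} (c : ℝ) (v : TangentSpace (𝓡 d) x) : dir (fun _ : M ↦ c) x v = 0 :=
  congrArg (fun φ ↦ φ v) (mvfderiv_const c)

/-- The Lie bracket of vector fields. -/
noncomputable abbrev br (X Y : VField d M) : VField d M := mlieBracket (𝓡 d) X Y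

theorem br_swap (X Y : VField d M) (x : M) : br X Y x = - br Y X x :=
  mlieBracket_swap_apply

theorem br_congr {X X' Y Y' : VField d M} {x : M} (h : X =ᶠ[𝓝 x] X') (h' : Y =ᶠ[𝓝 x] Y') :
    br X Y x = br X' Y' x :=
  h.mlieBracket_vectorField_eq h'

variable [IsManifold (𝓡 d) ∞ M]

/-- Smoothness of a vector field at a point. -/
def SmoothAt (X : VField d M) (x : M) : Prop :=
  ContMDiffAt (𝓡 d) (𝓡 d).tangent ∞ (fun y ↦ (⟨y, X y⟩ : TangentBundle (𝓡 d) M)) x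

/-- Differentiability of a vector field at a point. -/
def DiffAt (X : VField d M) (x : M) : Prop :=
  MDifferentiableAt (𝓡 d) (𝓡 d).tangent (fun y ↦ (⟨y, X y⟩ : TangentBundle (𝓡 d) M)) x

instance isManifold_one : IsManifold (𝓡 d) 1 M := .of_le (n := ∞) (by simp)
instance isManifold_minSmoothness_three : IsManifold (𝓡 d) (minSmoothness ℝ 3) M := by
  rw [minSmoothness_of_isRCLikeNormedField]; exact .of_le (n := ∞) (WithTop.coe_le_coe.2 le_top)

theorem SmoothAt.diffAt {X : VField d M} {x : M} (h : SmoothAt X x) : DiffAt X x :=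
  h.mdifferentiableAt (by simp)

/-- An identity between fields must hold near `x` before it can be differentiated at `x`. Regularity
of finite order spreads to a neighbourhood, so order one is extracted first. -/
theorem SmoothAt.eventually_diffAt {X : VField d M} {x : M} (h : SmoothAt X x) :
    ∀ᶠ y in 𝓝 x, DiffAt X y :=
  ((contMDiffAt_iff_contMDiffAt_nhds (n := 1) (by simp)).1
    (ContMDiffAt.of_le h (by simp))).mono fun _ hy ↦ hy.mdifferentiableAt (by simp)

theorem smoothAt_ext {x : M} (v : TangentSpace (𝓡 d) x) : SmoothAt (ext v) x :=
  FiberBundle.contMDiffAt_extend (k := ∞) (𝓡 d) (EuclideanSpace ℝ (Fin d)) v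

theorem ext_self {x : M} (v : TangentSpace (𝓡 d) x) : ext v x = v :=
  FiberBundle.extend_apply_self _ v

theorem SmoothAt.congr {X Y : VField d M} {x : M} (h : SmoothAt X x) (e : X =ᶠ[𝓝 x] Y) :
    SmoothAt Y x :=
  ContMDiffAt.congr_of_eventuallyEq h (e.mono fun y hy ↦ by simp [hy])

theorem SmoothAt.smul {f : M → ℝ} {X : VField d M} {x : M} (hf : SmoothFunAt d f x)
    (hX : SmoothAt X x) : SmoothAt (f • X) x :=
  ContMDiffAt.smul_section hf hX

theorem SmoothAt.add {X Y : VField d M} {x : M} (hX : SmoothAt X x)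
    (hY : SmoothAt Y x) : SmoothAt (X + Y) x :=
  ContMDiffAt.add_section hX hY

theorem SmoothAt.sub {X Y : VField d M} {x : M} (hX : SmoothAt X x)
    (hY : SmoothAt Y x) : SmoothAt (X - Y) x :=
  ContMDiffAt.sub_section hX hY

theorem SmoothAt.sum {ι : Type*} (s : Finset ι) {X : ι → VField d M} {x : M}
    (hX : ∀ i ∈ s, SmoothAt (X i) x) : SmoothAt (fun y ↦ ∑ i ∈ s, X i y) x :=
  ContMDiffAt.sum_section hX

theorem DiffAt.smul {f : M → ℝ} {X : VField d M} {x : M} (hf : DiffFunAt d f x)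
    (hX : DiffAt X x) : DiffAt (f • X) x :=
  MDifferentiableAt.smul_section hf hX

theorem DiffAt.add {X Y : VField d M} {x : M} (hX : DiffAt X x)
    (hY : DiffAt Y x) : DiffAt (X + Y) x :=
  mdifferentiableAt_add_section hX hY

theorem SmoothAt.br {X Y : VField d M} {x : M} (hX : SmoothAt X x) (hY : SmoothAt Y x) :
    SmoothAt (br X Y) x := by
  have : IsManifold (𝓡 d) (((⊤ : ℕ∞) : WithTop ℕ∞) + 1) M := by
    simpa using ‹IsManifold (𝓡 d) ∞ M›
  exact ContMDiffAt.mlieBracket_vectorField (n := ⊤) (m := ⊤) hX hY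
    (by rw [minSmoothness_of_isRCLikeNormedField]; simp)

theorem br_smul_right {f : M → ℝ} {X Y : VField d M} {x : M} (hf : DiffFunAt d f x)
    (hY : DiffAt Y x) : br X (f • Y) x = dir f x (X x) • Y x + f x • br X Y x :=
  mlieBracket_smul_right hf hY

theorem br_smul_left {f : M → ℝ} {X Y : VField d M} {x : M} (hf : DiffFunAt d f x)
    (hX : DiffAt X x) : br (f • X) Y x = - dir f x (Y x) • X x + f x • br X Y x :=
  mlieBracket_smul_left hf hX

theorem br_add_right {X Y Y' : VField d M} {x : M} (hY : DiffAt Y x) (hY' : DiffAt Y' x) :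
    br X (Y + Y') x = br X Y x + br X Y' x :=
  mlieBracket_add_right hY hY'

theorem br_add_left {X X' Y : VField d M} {x : M} (hX : DiffAt X x) (hX' : DiffAt X' x) :
    br (X + X') Y x = br X Y x + br X' Y x :=
  mlieBracket_add_left hX hX'

theorem jacobi {X Y Z : VField d M} {x : M} (hX : SmoothAt X x) (hY : SmoothAt Y x)
    (hZ : SmoothAt Z x) : br X (br Y Z) x = br (br X Y) Z x + br Y (br X Z) x := by
  have h : minSmoothness ℝ 2 ≤ (∞ : WithTop ℕ∞) := by
    rw [minSmoothness_of_isRCLikeNormedField]; exact WithTop.coe_le_coe.2 le_top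
  exact leibniz_identity_mlieBracket_apply (hX.of_le h) (hY.of_le h) (hZ.of_le h)

namespace LorentzMetric

variable (g : LorentzMetric d M)

theorem pair_smoothFunAt {X Y : VField d M} {x : M} (hX : SmoothAt X x) (hY : SmoothAt Y x) :
    SmoothFunAt d (g.pair X Y) x := by
  have := ContMDiffAt.clm_bundle_apply₂ (F₃ := ℝ) (E₃ := Bundle.Trivial M ℝ)
    (g.contMDiff x) hX hY
  simp only [contMDiffAt_section] at this
  exact this

theorem pair_diffFunAt {X Y : VField d M} {x : M} (hX : DiffAt X x) (hY : DiffAt Y x) :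
    DiffFunAt d (g.pair X Y) x := by
  have := MDifferentiableAt.clm_bundle_apply₂ (F₃ := ℝ) (E₃ := Bundle.Trivial M ℝ)
    ((g.contMDiff x).mdifferentiableAt (by simp)) hX hY
  simp only [mdifferentiableAt_section] at this
  exact this

end LorentzMetric
end

/-! ### Linear algebra of the metric: Gram matrices, index raising, traces. -/

section

variable {d : ℕ} {M : Type*} [TopologicalSpace M] [ChartedSpace (EuclideanSpace ℝ (Fin d)) M]

/-- The coordinate basis of the tangent space. -/
noncomputable def coordBasis (x : M) : Module.Basis (Fin d) ℝ (TangentSpace (𝓡 d) x) :=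
  (EuclideanSpace.basisFun (Fin d) ℝ).toBasis

theorem coordBasis_apply (x : M) (i : Fin d) : coordBasis x i = coordVec x i := by
  change (EuclideanSpace.basisFun (Fin d) ℝ).toBasis i = _
  simp [coordVec]

theorem finrank_tangentSpace (x : M) : Module.finrank ℝ (TangentSpace (𝓡 d) x) = d := by
  simpa using Module.finrank_eq_card_basis (coordBasis x)

instance finiteDimensional_tangentSpace (x : M) :
    FiniteDimensional ℝ (TangentSpace (𝓡 d) x) :=
  (coordBasis x).finiteDimensional_of_finite

variable [IsManifold (𝓡 d) ∞ M]

namespace LorentzMetric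

variable (g : LorentzMetric d M)

theorem eq_zero_of_forall {x : M} {v : TangentSpace (𝓡 d) x}
    (h : ∀ w, g.val x v w = 0) : v = 0 := by
  obtain ⟨b, hb⟩ := g.signature x
  rw [← b.sum_repr v]
  refine Finset.sum_eq_zero fun i _ ↦ ?_
  have := h (b i)
  rw [← b.sum_repr v] at this
  simp only [map_sum, map_smul, sum_apply, smul_apply, hb, smul_eq_mul, mul_ite, mul_zero,
    Finset.sum_ite_eq', Finset.mem_univ, if_true] at this
  have h0 : b.repr v i = 0 := by split_ifs at this <;> linarith
  rw [h0, zero_smul]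

theorem ext_inner {x : M} {v v' : TangentSpace (𝓡 d) x}
    (h : ∀ w, g.val x v w = g.val x v' w) : v = v' := by
  rw [← sub_eq_zero]
  exact g.eq_zero_of_forall fun w ↦ by simp [h w]

/-- The Gram matrix of a family of tangent vectors. -/
noncomputable def gram {ι : Type*} {x : M} (E : ι → TangentSpace (𝓡 d) x) : Matrix ι ι ℝ :=
  Matrix.of fun i j ↦ g.val x (E i) (E j)

section gram

variable {ι : Type*} [Fintype ι] [DecidableEq ι] {x : M} {E : ι → TangentSpace (𝓡 d) x}

theorem det_gram_ne_zero (b : Module.Basis ι ℝ (TangentSpace (𝓡 d) x)) :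
    (g.gram b).det ≠ 0 := by
  intro h
  obtain ⟨v, hv, h⟩ := Matrix.exists_mulVec_eq_zero_iff.2 h
  have he (i : ι) : g.val x (b i) (∑ j, v j • b j) = 0 := by
    have := congrFun h i
    simp only [Matrix.mulVec, dotProduct, gram, Matrix.of_apply, Pi.zero_apply] at this
    simpa [mul_comm] using this
  have hw : ∑ j, v j • b j = 0 := by
    refine g.eq_zero_of_forall fun w ↦ ?_
    generalize ∑ j, v j • b j = s at he ⊢
    rw [g.symm, ← b.sum_repr w]
    simp only [map_sum, map_smul, sum_apply, smul_apply, he, smul_zero, Finset.sum_const_zero]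
  exact hv (funext fun j ↦ Fintype.linearIndependent_iff.1 b.linearIndependent v hw j)

theorem linearIndependent_of_det_gram_ne_zero (h : (g.gram E).det ≠ 0) :
    LinearIndependent ℝ E := by
  refine Fintype.linearIndependent_iff.2 fun c hc ↦ ?_
  by_contra! hne
  refine h (Matrix.exists_mulVec_eq_zero_iff.1 ⟨c, fun h0 ↦ ?_, ?_⟩)
  · obtain ⟨i, hi⟩ := hne
    exact hi (congrFun h0 i)
  · funext i
    have := congrArg (g.val x (E i)) hc
    simp only [map_sum, map_smul, smul_eq_mul, map_zero] at this
    simpa [Matrix.mulVec, dotProduct, gram, mul_comm] using this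

/-- The expansion of a vector in a frame, by means of the inverse Gram matrix. -/
theorem sum_inv_gram (hE : Fintype.card ι = d) (h : (g.gram E).det ≠ 0)
    (v : TangentSpace (𝓡 d) x) :
    ∑ i, ∑ j, ((g.gram E)⁻¹ i j * g.val x v (E i)) • E j = v := by
  have hli := g.linearIndependent_of_det_gram_ne_zero h
  have hc : Fintype.card ι = Module.finrank ℝ (TangentSpace (𝓡 d) x) := by
    rw [finrank_tangentSpace, hE]
  have hsp : ⊤ ≤ Submodule.span ℝ (Set.range E) :=
    (hli.span_eq_top_of_card_eq_finrank' hc).ge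
  let b := Module.Basis.mk hli hsp
  have hb (i) : b i = E i := by simp [b]
  have key (j : ι) : ∑ i, (g.gram E)⁻¹ i j * g.val x v (E i) = b.repr v j := by
    have h1 (i) : g.val x v (E i) = ∑ k, b.repr v k * g.gram E k i := by
      conv_lhs => rw [← b.sum_repr v]
      simp [hb, gram]
    have h2 : g.gram E * (g.gram E)⁻¹ = 1 := Matrix.mul_nonsing_inv _ (isUnit_iff_ne_zero.2 h)
    calc ∑ i, (g.gram E)⁻¹ i j * g.val x v (E i)
        = ∑ k, b.repr v k * ∑ i, g.gram E k i * (g.gram E)⁻¹ i j := by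
          simp only [h1, Finset.mul_sum]
          rw [Finset.sum_comm]
          exact Finset.sum_congr rfl fun k _ ↦ Finset.sum_congr rfl fun i _ ↦ by ring
      _ = ∑ k, b.repr v k * (1 : Matrix ι ι ℝ) k j := by
          simp only [← Matrix.mul_apply, h2]
      _ = b.repr v j := by simp [Matrix.one_apply]
  rw [Finset.sum_comm]
  simp only [← Finset.sum_smul, key]
  conv_rhs => rw [← b.sum_repr v]
  simp [hb]

end gram

theorem gram_coordVec (x : M) : (g.gram (coordVec x))⁻¹ = g.inv x := rfl

theorem det_gram_coordVec (x : M) : (g.gram (coordVec x)).det ≠ 0 := by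
  have := g.det_gram_ne_zero (coordBasis x)
  rwa [show ⇑(coordBasis x) = coordVec x from funext (coordBasis_apply x)] at this

theorem sum_inv (x : M) (v : TangentSpace (𝓡 d) x) :
    ∑ i, ∑ j, (g.inv x i j * g.val x v (coordVec x i)) • coordVec x j = v :=
  g.sum_inv_gram (by simp) (g.det_gram_coordVec x) v

/-- A linear functional is represented by its `sharp`. -/
theorem val_sharp {x : M} {φ : TangentSpace (𝓡 d) x → ℝ} (hφ : IsLinearMap ℝ φ)
    (w : TangentSpace (𝓡 d) x) : g.val x (g.sharp x φ) w = φ w := by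
  have hs : (g.inv x)ᵀ = g.inv x := by
    rw [← gram_coordVec, Matrix.transpose_nonsing_inv]
    congr 1
    ext i j
    exact g.symm _ _ _
  have h : ∑ i, ∑ j, (g.inv x i j * g.val x w (coordVec x i)) * φ (coordVec x j) = φ w := by
    conv_rhs => rw [← g.sum_inv x w]
    change _ = hφ.mk' φ _
    simp
  rw [← h, sharp]
  simp only [map_sum, map_smul, sum_apply, smul_apply, smul_eq_mul]
  rw [Finset.sum_comm]
  refine Finset.sum_congr rfl fun i _ ↦ Finset.sum_congr rfl fun j _ ↦ ?_
  rw [← Matrix.transpose_apply (g.inv x) i j, hs, g.symm x w]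
  ring

/-- The trace of a bilinear form can be computed in any frame. -/
theorem sum_inv_bilin {ι : Type*} [Fintype ι] [DecidableEq ι] {x : M}
    {E : ι → TangentSpace (𝓡 d) x} (hE : Fintype.card ι = d) (h : (g.gram E).det ≠ 0)
    (B : TangentSpace (𝓡 d) x →ₗ[ℝ] TangentSpace (𝓡 d) x →ₗ[ℝ] ℝ) :
    ∑ i, ∑ j, g.inv x i j * B (coordVec x i) (coordVec x j) =
      ∑ a, ∑ b, (g.gram E)⁻¹ a b * B (E b) (E a) := by
  -- Expanding one argument on each side, `E a` in the coordinate basis and `coordVec x i` in the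
  -- frame, turns both traces into the same fourfold sum.
  have h1 (a b : ι) : B (E b) (E a) =
      ∑ i, ∑ j, g.inv x i j * g.val x (E a) (coordVec x i) * B (E b) (coordVec x j) := by
    conv_lhs => rw [← g.sum_inv x (E a)]
    simp
  have h2 (i j : Fin d) : B (coordVec x i) (coordVec x j) =
      ∑ a, ∑ b, (g.gram E)⁻¹ a b * g.val x (E a) (coordVec x i) * B (E b) (coordVec x j) := by
    conv_lhs => rw [← g.sum_inv_gram hE h (coordVec x i)]
    simp [g.symm x (coordVec x i)]
  simp only [h1, h2, Finset.mul_sum]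
  have e1 : ∀ f : Fin d → Fin d → ι → ι → ℝ, ∑ i, ∑ j, ∑ a, ∑ b, f i j a b =
      ∑ a, ∑ b, ∑ i, ∑ j, f i j a b := by
    intro f
    calc _ = ∑ i, ∑ a, ∑ j, ∑ b, f i j a b := Finset.sum_congr rfl fun i _ ↦ Finset.sum_comm
      _ = ∑ a, ∑ i, ∑ j, ∑ b, f i j a b := Finset.sum_comm
      _ = ∑ a, ∑ i, ∑ b, ∑ j, f i j a b := Finset.sum_congr rfl fun a _ ↦
        Finset.sum_congr rfl fun i _ ↦ Finset.sum_comm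
      _ = _ := Finset.sum_congr rfl fun a _ ↦ Finset.sum_comm
  rw [e1]
  refine Finset.sum_congr rfl fun a _ ↦ Finset.sum_congr rfl fun b _ ↦ Finset.sum_congr rfl
    fun i _ ↦ Finset.sum_congr rfl fun j _ ↦ by ring

end LorentzMetric
end

/-! ### The Koszul formula and the Levi-Civita connection. -/

section

variable {d : ℕ} {M : Type*} [TopologicalSpace M] [ChartedSpace (EuclideanSpace ℝ (Fin d)) M]
variable [IsManifold (𝓡 d) ∞ M]

theorem diffAt_ext {x : M} (v : TangentSpace (𝓡 d) x) : DiffAt (ext v) x :=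
  (smoothAt_ext v).diffAt

namespace LorentzMetric

variable (g : LorentzMetric d M)

theorem pair_smul_left (f : M → ℝ) (X Y : VField d M) :
    g.pair (f • X) Y = fun y ↦ f y * g.pair X Y y := by
  funext y; simp [pair]

theorem pair_smul_right (f : M → ℝ) (X Y : VField d M) :
    g.pair X (f • Y) = fun y ↦ f y * g.pair X Y y := by
  funext y; simp [pair]

theorem pair_add_left (X X' Y : VField d M) :
    g.pair (X + X') Y = fun y ↦ g.pair X Y y + g.pair X' Y y := by
  funext y; simp [pair]

theorem pair_add_right (X Y Y' : VField d M) :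
    g.pair X (Y + Y') = fun y ↦ g.pair X Y y + g.pair X Y' y := by
  funext y; simp [pair]

theorem pair_comm (X Y : VField d M) : g.pair X Y = g.pair Y X :=
  funext fun y ↦ g.symm y _ _

section koszul

variable {X X' Y Y' Z Z' : VField d M} {f : M → ℝ} {x : M}

theorem koszul_eq (X Y Z : VField d M) (x : M) : g.koszul X Y Z x =
    (dir (g.pair Y Z) x (X x) + dir (g.pair Z X) x (Y x) - dir (g.pair X Y) x (Z x)
    + g.val x (br X Y x) (Z x) - g.val x (br Y Z x) (X x) - g.val x (br X Z x) (Y x)) / 2 := rfl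

theorem koszul_smul_right (hX : DiffAt X x) (hY : DiffAt Y x) (hZ : DiffAt Z x)
    (hf : DiffFunAt d f x) : g.koszul X Y (f • Z) x = f x * g.koszul X Y Z x := by
  simp only [koszul_eq, pair_smul_left, pair_smul_right, Pi.smul_apply', map_smul, smul_eq_mul,
    dir_mul hf (g.pair_diffFunAt hY hZ), dir_mul hf (g.pair_diffFunAt hZ hX),
    br_smul_right hf hZ, map_add, add_apply, smul_apply]
  simp only [pair, g.symm x (Z x)]
  ring

theorem koszul_smul_left (hX : DiffAt X x) (hY : DiffAt Y x) (hZ : DiffAt Z x)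
    (hf : DiffFunAt d f x) : g.koszul (f • X) Y Z x = f x * g.koszul X Y Z x := by
  simp only [koszul_eq, pair_smul_left, pair_smul_right, Pi.smul_apply', map_smul, smul_eq_mul,
    dir_mul hf (g.pair_diffFunAt hX hY), dir_mul hf (g.pair_diffFunAt hZ hX),
    br_smul_left hf hX, map_add, add_apply, smul_apply, map_neg, neg_smul, neg_apply]
  simp only [pair, g.symm x (Z x)]
  ring

theorem koszul_add_right (hX : DiffAt X x) (hY : DiffAt Y x) (hZ : DiffAt Z x)
    (hZ' : DiffAt Z' x) : g.koszul X Y (Z + Z') x = g.koszul X Y Z x + g.koszul X Y Z' x := by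
  simp only [koszul_eq, pair_add_left, pair_add_right, Pi.add_apply, map_add,
    dir_add (g.pair_diffFunAt hY hZ) (g.pair_diffFunAt hY hZ'),
    dir_add (g.pair_diffFunAt hZ hX) (g.pair_diffFunAt hZ' hX),
    br_add_right hZ hZ', add_apply]
  ring

theorem koszul_add_left (hX : DiffAt X x) (hX' : DiffAt X' x) (hY : DiffAt Y x)
    (hZ : DiffAt Z x) : g.koszul (X + X') Y Z x = g.koszul X Y Z x + g.koszul X' Y Z x := by
  simp only [koszul_eq, pair_add_left, pair_add_right, Pi.add_apply, map_add,
    dir_add (g.pair_diffFunAt hX hY) (g.pair_diffFunAt hX' hY),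
    dir_add (g.pair_diffFunAt hZ hX) (g.pair_diffFunAt hZ hX'),
    br_add_left hX hX', add_apply]
  ring

theorem koszul_add_mid (hX : DiffAt X x) (hY : DiffAt Y x) (hY' : DiffAt Y' x)
    (hZ : DiffAt Z x) : g.koszul X (Y + Y') Z x = g.koszul X Y Z x + g.koszul X Y' Z x := by
  simp only [koszul_eq, pair_add_left, pair_add_right, Pi.add_apply, map_add,
    dir_add (g.pair_diffFunAt hX hY) (g.pair_diffFunAt hX hY'),
    dir_add (g.pair_diffFunAt hY hZ) (g.pair_diffFunAt hY' hZ),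
    br_add_left hY hY', br_add_right hY hY', add_apply]
  ring

theorem koszul_tensorial_right (hX : DiffAt X x) (hY : DiffAt Y x) :
    TensorialAt (𝓡 d) (EuclideanSpace ℝ (Fin d)) (fun Z : VField d M ↦ g.koszul X Y Z x) x where
  smul hf hZ := g.koszul_smul_right hX hY hZ hf
  add hZ hZ' := g.koszul_add_right hX hY hZ hZ'

theorem koszul_tensorial_left (hY : DiffAt Y x) (hZ : DiffAt Z x) :
    TensorialAt (𝓡 d) (EuclideanSpace ℝ (Fin d)) (fun X : VField d M ↦ g.koszul X Y Z x) x where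
  smul hf hX := g.koszul_smul_left hX hY hZ hf
  add hX hX' := g.koszul_add_left hX hX' hY hZ

/-- The Koszul expression is function-linear in its first and third fields: derivatives of the
factor coming from the metric terms cancel those from the brackets. Hence the extensions `ext` in
the definition of `nabla` may be replaced by any others. -/
theorem koszul_congr (hX : DiffAt X x) (hX' : DiffAt X' x) (hY : DiffAt Y x) (hZ : DiffAt Z x)
    (hZ' : DiffAt Z' x) (eX : X x = X' x) (eZ : Z x = Z' x) :
    g.koszul X Y Z x = g.koszul X' Y Z' x :=
  ((g.koszul_tensorial_left hY hZ).pointwise hX hX' eX).trans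
    ((g.koszul_tensorial_right hX' hY).pointwise hZ hZ' eZ)

theorem isLinearMap_koszul_ext (hX : DiffAt X x) (hY : DiffAt Y x) :
    IsLinearMap ℝ fun z : TangentSpace (𝓡 d) x ↦ g.koszul X Y (ext z) x where
  map_add z z' := by
    rw [← g.koszul_add_right hX hY (diffAt_ext z) (diffAt_ext z')]
    exact g.koszul_congr hX hX hY (diffAt_ext _) ((diffAt_ext z).add (diffAt_ext z')) rfl
      (by simp [ext_self])
  map_smul c z := by
    have hc : DiffFunAt d (fun _ : M ↦ c) x := mdifferentiableAt_const
    rw [smul_eq_mul, ← g.koszul_smul_right hX hY (diffAt_ext z) hc]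
    exact g.koszul_congr hX hX hY (diffAt_ext _) ((diffAt_ext z).smul hc) rfl
      (by simp [ext_self])

/-- The Koszul formula. -/
theorem val_nabla (hX : DiffAt X x) (hY : DiffAt Y x) (hZ : DiffAt Z x) :
    g.val x (g.nabla Y x (X x)) (Z x) = g.koszul X Y Z x := by
  rw [nabla, g.val_sharp (g.isLinearMap_koszul_ext (diffAt_ext _) hY)]
  exact g.koszul_congr (diffAt_ext _) hX hY (diffAt_ext _) hZ (ext_self _) (ext_self _)

theorem val_nabla_ext (hX : DiffAt X x) (hY : DiffAt Y x) (w : TangentSpace (𝓡 d) x) :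
    g.val x (g.nabla Y x (X x)) w = g.koszul X Y (ext w) x := by
  conv_lhs => rw [← ext_self w]
  exact g.val_nabla hX hY (diffAt_ext w)

theorem nabla_congr (hY : DiffAt Y x) (hY' : DiffAt Y' x) (e : Y =ᶠ[𝓝 x] Y')
    (v : TangentSpace (𝓡 d) x) : g.nabla Y x v = g.nabla Y' x v := by
  refine g.ext_inner fun w ↦ ?_
  rw [← ext_self v, g.val_nabla_ext (diffAt_ext v) hY, g.val_nabla_ext (diffAt_ext v) hY']
  simp only [koszul_eq]
  have e1 : g.pair Y (ext w) =ᶠ[𝓝 x] g.pair Y' (ext w) := e.mono fun y hy ↦ by simp [pair, hy]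
  have e2 : g.pair (ext v) Y =ᶠ[𝓝 x] g.pair (ext v) Y' := e.mono fun y hy ↦ by simp [pair, hy]
  have e3 : br (ext v) Y x = br (ext v) Y' x := br_congr EventuallyEq.rfl e
  have e4 : br Y (ext w) x = br Y' (ext w) x := br_congr e EventuallyEq.rfl
  rw [dir_congr e1, dir_congr e2, e3, e4, e.self_of_nhds]

theorem nabla_add_vec (hY : DiffAt Y x) (v v' : TangentSpace (𝓡 d) x) :
    g.nabla Y x (v + v') = g.nabla Y x v + g.nabla Y x v' := by
  refine g.ext_inner fun w ↦ ?_
  have hv := g.val_nabla_ext ((diffAt_ext v).add (diffAt_ext v')) hY w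
  rw [g.koszul_add_left (diffAt_ext v) (diffAt_ext v') hY (diffAt_ext w),
    ← g.val_nabla_ext (diffAt_ext v) hY, ← g.val_nabla_ext (diffAt_ext v') hY] at hv
  simpa [ext_self] using hv

theorem nabla_smul_vec (hY : DiffAt Y x) (c : ℝ) (v : TangentSpace (𝓡 d) x) :
    g.nabla Y x (c • v) = c • g.nabla Y x v := by
  refine g.ext_inner fun w ↦ ?_
  have hc : DiffFunAt d (fun _ : M ↦ c) x := mdifferentiableAt_const
  have hv := g.val_nabla_ext ((diffAt_ext v).smul hc) hY w
  rw [g.koszul_smul_left (diffAt_ext v) hY (diffAt_ext w) hc,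
    ← g.val_nabla_ext (diffAt_ext v) hY] at hv
  simpa [ext_self] using hv

theorem nabla_add (hY : DiffAt Y x) (hY' : DiffAt Y' x) (v : TangentSpace (𝓡 d) x) :
    g.nabla (Y + Y') x v = g.nabla Y x v + g.nabla Y' x v := by
  refine g.ext_inner fun w ↦ ?_
  have hv := g.koszul_add_mid (diffAt_ext v) hY hY' (diffAt_ext w)
  rw [← g.val_nabla_ext (diffAt_ext v) hY, ← g.val_nabla_ext (diffAt_ext v) hY',
    ← g.val_nabla_ext (diffAt_ext v) (hY.add hY')] at hv
  simpa [ext_self] using hv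

/-- The Levi-Civita connection is torsion-free. -/
theorem nabla_sub_nabla (hX : DiffAt X x) (hY : DiffAt Y x) :
    g.nabla Y x (X x) - g.nabla X x (Y x) = br X Y x := by
  refine g.ext_inner fun w ↦ ?_
  rw [map_sub, sub_apply, g.val_nabla_ext hX hY, g.val_nabla_ext hY hX]
  simp only [koszul_eq, br_swap Y X, g.pair_comm (ext w), g.pair_comm Y X, map_neg, neg_apply,
    ext_self]
  ring

/-- The Levi-Civita connection is compatible with the metric. -/
theorem dir_pair (hX : DiffAt X x) (hY : DiffAt Y x) (hZ : DiffAt Z x) :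
    dir (g.pair Y Z) x (X x) =
      g.val x (g.nabla Y x (X x)) (Z x) + g.val x (Y x) (g.nabla Z x (X x)) := by
  rw [g.symm x (Y x), g.val_nabla hX hY hZ, g.val_nabla hX hZ hY]
  simp only [koszul_eq, br_swap Z Y, g.pair_comm X, g.pair_comm Z Y, map_neg, neg_apply]
  ring

end koszul

end LorentzMetric
end

/-! ### Smoothness of covariant derivatives, and brackets as commutators. -/

section

variable {d : ℕ} {M : Type*} [TopologicalSpace M] [ChartedSpace (EuclideanSpace ℝ (Fin d)) M]

section functions

variable {f h : M → ℝ} {x : M}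

theorem SmoothFunAt.mul (hf : SmoothFunAt d f x) (hh : SmoothFunAt d h x) :
    SmoothFunAt d (fun y ↦ f y * h y) x := ContMDiffAt.mul hf hh

theorem SmoothFunAt.add (hf : SmoothFunAt d f x) (hh : SmoothFunAt d h x) :
    SmoothFunAt d (fun y ↦ f y + h y) x := ContMDiffAt.add hf hh

theorem SmoothFunAt.sub (hf : SmoothFunAt d f x) (hh : SmoothFunAt d h x) :
    SmoothFunAt d (fun y ↦ f y - h y) x := ContMDiffAt.sub hf hh

theorem SmoothFunAt.const (c : ℝ) : SmoothFunAt d (fun _ : M ↦ c) x := contMDiffAt_const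

theorem SmoothFunAt.congr (hf : SmoothFunAt d f x) (e : f =ᶠ[𝓝 x] h) : SmoothFunAt d h x :=
  ContMDiffAt.congr_of_eventuallyEq hf e.symm

theorem SmoothFunAt.det {ι : Type*} [Fintype ι] [DecidableEq ι] {A : M → Matrix ι ι ℝ}
    (hA : ∀ i j, SmoothFunAt d (fun y ↦ A y i j) x) : SmoothFunAt d (fun y ↦ (A y).det) x := by
  simp only [Matrix.det_apply']
  exact contMDiffAt_finsetSum fun σ _ ↦ (SmoothFunAt.const _).mul
    (contMDiffAt_finsetProd fun i _ ↦ hA _ _)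

theorem SmoothFunAt.matrix_inv {ι : Type*} [Fintype ι] [DecidableEq ι] {A : M → Matrix ι ι ℝ}
    (hA : ∀ i j, SmoothFunAt d (fun y ↦ A y i j) x) (h0 : (A x).det ≠ 0) (i j : ι) :
    SmoothFunAt d (fun y ↦ (A y)⁻¹ i j) x := by
  simp only [Matrix.inv_def, Matrix.smul_apply, smul_eq_mul, Ring.inverse_eq_inv,
    Matrix.adjugate_apply]
  refine (ContMDiffAt.inv₀ (SmoothFunAt.det hA) h0).mul (SmoothFunAt.det fun k l ↦ ?_)
  simp only [Matrix.updateRow_apply]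
  split_ifs
  exacts [.const _, hA k l]

end functions

variable [IsManifold (𝓡 d) ∞ M]

theorem SmoothFunAt.eventually_diffFunAt {f : M → ℝ} {x : M} (h : SmoothFunAt d f x) :
    ∀ᶠ y in 𝓝 x, DiffFunAt d f y :=
  ((contMDiffAt_iff_contMDiffAt_nhds (n := 1) (by simp)).1
    (ContMDiffAt.of_le h (by simp))).mono fun _ hy ↦ hy.mdifferentiableAt (by simp)

namespace LorentzMetric

variable (g : LorentzMetric d M)

/-- A vector field is smooth as soon as its inner products with smooth fields are. -/
theorem smoothAt_of_pair {V : VField d M} {x : M}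
    (h : ∀ W : VField d M, SmoothAt W x → SmoothFunAt d (g.pair V W) x) : SmoothAt V x := by
  -- The vectors `coordVec y` refer to the preferred chart at `y`, which need not vary smoothly with
  -- `y`. Extending the basis at `x` gives a smooth frame, whose Gram matrix stays invertible near
  -- `x`.
  let E (y : M) (i : Fin d) : TangentSpace (𝓡 d) y := ext (coordVec x i) y
  have hE (i) : SmoothAt (fun y ↦ E y i) x := smoothAt_ext _
  have hG (i j) : SmoothFunAt d (fun y ↦ g.gram (E y) i j) x := g.pair_smoothFunAt (hE i) (hE j)
  have hx : (g.gram (E x)).det ≠ 0 := by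
    have e : E x = coordVec x := funext fun i ↦ ext_self _
    rw [e]
    exact g.det_gram_coordVec x
  have hev : ∀ᶠ y in 𝓝 x, (g.gram (E y)).det ≠ 0 :=
    (SmoothFunAt.det hG).continuousAt.eventually_ne hx
  have hs : SmoothAt (fun y ↦ ∑ i, ∑ j, ((g.gram (E y))⁻¹ i j * g.val y (V y) (E y i)) • E y j)
      x :=
    .sum _ fun i _ ↦ .sum _ fun j _ ↦
      .smul ((SmoothFunAt.matrix_inv hG hx i j).mul (h _ (hE i))) (hE j)
  exact hs.congr (hev.mono fun y hy ↦ g.sum_inv_gram (by simp) hy (V y))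

theorem exists_val_ne_zero {x : M} {v : TangentSpace (𝓡 d) x} (hv : v ≠ 0) :
    ∃ w, g.val x v w ≠ 0 := by
  by_contra! h
  exact hv (g.eq_zero_of_forall h)

/-- The Leibniz rule [X, fZ] = (Xf) Z + f [X, Z], paired with a field W such that g(Z, W) ≠ 0,
expresses Xf as a quotient of smooth functions. If the tangent space is zero, then d = 0 and the
derivative vanishes identically. -/
theorem smoothFunAt_dir (g : LorentzMetric d M) {f : M → ℝ} {X : VField d M} {x : M}
    (hf : SmoothFunAt d f x) (hX : SmoothAt X x) : SmoothFunAt d (fun y ↦ dir f y (X y)) x := by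
  by_cases h0 : ∃ v : TangentSpace (𝓡 d) x, v ≠ 0
  · obtain ⟨v, hv⟩ := h0
    obtain ⟨w, hw⟩ := g.exists_val_ne_zero hv
    have hZ := smoothAt_ext v
    have hW := smoothAt_ext w
    have hp : SmoothFunAt d (g.pair (ext v) (ext w)) x := g.pair_smoothFunAt hZ hW
    have hp0 : g.pair (ext v) (ext w) x ≠ 0 := by simpa [pair, ext_self] using hw
    have hs : SmoothFunAt d (fun y ↦ (g.pair (br X (f • ext v)) (ext w) y -
        f y * g.pair (br X (ext v)) (ext w) y) / g.pair (ext v) (ext w) y) x :=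
      ContMDiffAt.div₀ ((g.pair_smoothFunAt (hX.br (hZ.smul hf)) hW).sub
        (hf.mul (g.pair_smoothFunAt (hX.br hZ) hW))) hp hp0
    refine hs.congr ?_
    filter_upwards [hp.continuousAt.eventually_ne hp0, hf.eventually_diffFunAt,
      hZ.eventually_diffAt] with y hy hfy hZy
    rw [div_eq_iff hy]
    simp [pair, br_smul_right hfy hZy]
  · push Not at h0
    have hd : d = 0 := by
      rw [← finrank_tangentSpace (d := d) x]
      have : Subsingleton (TangentSpace (𝓡 d) x) := ⟨fun a b ↦ by rw [h0 a, h0 b]⟩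
      exact Module.finrank_zero_of_subsingleton
    have hX0 (y : M) : X y = 0 := by
      have : Subsingleton (TangentSpace (𝓡 d) y) :=
        Module.finrank_zero_iff.1 ((finrank_tangentSpace y).trans hd)
      exact Subsingleton.elim _ _
    simp only [hX0, map_zero]
    exact .const _

/-- The covariant derivative of smooth fields is smooth. -/
theorem smoothAt_nabla {X Y : VField d M} {x : M} (hX : SmoothAt X x) (hY : SmoothAt Y x) :
    SmoothAt (fun y ↦ g.nabla Y y (X y)) x := by
  refine g.smoothAt_of_pair fun Z hZ ↦ ?_
  have hs : SmoothFunAt d (g.koszul X Y Z) x := by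
    refine SmoothFunAt.congr (.mul ?_ (.const 2⁻¹))
      (.of_forall fun y ↦ (div_eq_mul_inv _ (2 : ℝ)).symm)
    exact (((((g.smoothFunAt_dir (g.pair_smoothFunAt hY hZ) hX).add
      (g.smoothFunAt_dir (g.pair_smoothFunAt hZ hX) hY)).sub
      (g.smoothFunAt_dir (g.pair_smoothFunAt hX hY) hZ)).add
      (g.pair_smoothFunAt (hX.br hY) hZ)).sub
      (g.pair_smoothFunAt (hY.br hZ) hX)).sub
      (g.pair_smoothFunAt (hX.br hZ) hY)
  refine hs.congr ?_
  filter_upwards [hX.eventually_diffAt, hY.eventually_diffAt, hZ.eventually_diffAt]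
    with y hXy hYy hZy
  exact (g.val_nabla hXy hYy hZy).symm

/-- The Lie bracket acts on functions as the commutator of derivations. -/
theorem dir_br (g : LorentzMetric d M) {f : M → ℝ} {X Y : VField d M} {x : M}
    (hf : SmoothFunAt d f x) (hX : SmoothAt X x) (hY : SmoothAt Y x) :
    dir f x (br X Y x) =
      dir (fun y ↦ dir f y (Y y)) x (X x) - dir (fun y ↦ dir f y (X y)) x (Y x) := by
  by_cases h0 : ∃ v : TangentSpace (𝓡 d) x, v ≠ 0
  · obtain ⟨v, hv⟩ := h0
    have hZ := smoothAt_ext v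
    have hfd := hf.diffFunAt
    -- The Jacobi identity is applied to X, Y and fZ, where Z extends `v`. The mixed first-order
    -- terms are symmetric in X and Y and cancel, the terms in f cancel by the Jacobi identity for
    -- Z, and the coefficient of `v` is the claim.
    have key {U V : VField d M} (hU : SmoothAt U x) (hV : SmoothAt V x) :
        br U (br V (f • ext v)) x = dir (fun y ↦ dir f y (V y)) x (U x) • v
          + dir f x (V x) • br U (ext v) x + (dir f x (U x) • br V (ext v) x
          + f x • br U (br V (ext v)) x) := by
      have e : br V (f • ext v) =ᶠ[𝓝 x] (fun y ↦ dir f y (V y)) • ext v + f • br V (ext v) := by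
        filter_upwards [hf.eventually_diffFunAt, hZ.eventually_diffAt] with y hfy hZy
        exact br_smul_right hfy hZy
      have hdf := g.smoothFunAt_dir hf hV
      have hbr := hV.br hZ
      have e' : br U (br V (f • ext v)) x =
          br U ((fun y ↦ dir f y (V y)) • ext v + f • br V (ext v)) x :=
        br_congr EventuallyEq.rfl e
      rw [e', br_add_right (hZ.smul hdf).diffAt (hbr.smul hf).diffAt,
        br_smul_right hdf.diffFunAt hZ.diffAt, br_smul_right hfd hbr.diffAt, ext_self]
    have h1 := jacobi hX hY (hZ.smul hf)
    rw [key hX hY, key hY hX, br_smul_right hfd hZ.diffAt, jacobi hX hY hZ, ext_self] at h1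
    have h2 : (dir f x (br X Y x) - (dir (fun y ↦ dir f y (Y y)) x (X x)
        - dir (fun y ↦ dir f y (X y)) x (Y x))) • v = 0 := by
      rw [sub_smul, sub_smul]
      rw [smul_add, ← sub_eq_zero] at h1
      rw [← neg_eq_zero, ← h1]
      abel
    exact sub_eq_zero.1 ((smul_eq_zero.1 h2).resolve_right hv)
  · push Not at h0
    rw [h0 (br X Y x), h0 (X x), h0 (Y x)]
    simp

/-! ### Symmetries and tensoriality of the curvature. -/

section fields

variable {X X' Y Y' Z Z' W W' : VField d M} {x : M}

theorem nabla_neg_vec (hY : DiffAt Y x) (v : TangentSpace (𝓡 d) x) :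
    g.nabla Y x (-v) = -g.nabla Y x v := by
  simpa using g.nabla_smul_vec hY (-1) v

theorem curv_swap (hZ : DiffAt Z x) : g.curv Y X Z x = -g.curv X Y Z x := by
  have h : mlieBracket (𝓡 d) Y X x = -mlieBracket (𝓡 d) X Y x := br_swap Y X x
  simp only [curv, h, g.nabla_neg_vec hZ]
  abel

/-- The function g(Z, W) is differentiated twice by metric compatibility. In the commutator the
products of first derivatives cancel, and comparison with the derivative along [X, Y] leaves
g(R(X,Y)Z, W) + g(Z, R(X,Y)W) = 0. -/
theorem val_curv_antisymm (hX : SmoothAt X x) (hY : SmoothAt Y x) (hZ : SmoothAt Z x)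
    (hW : SmoothAt W x) :
    g.val x (g.curv X Y Z x) (W x) = -g.val x (g.curv X Y W x) (Z x) := by
  have second {U V : VField d M} (hU : SmoothAt U x) (hV : SmoothAt V x) :
      dir (fun y ↦ dir (g.pair Z W) y (V y)) x (U x) =
        g.val x (g.nabla (fun y ↦ g.nabla Z y (V y)) x (U x)) (W x)
        + g.val x (g.nabla Z x (V x)) (g.nabla W x (U x))
        + (g.val x (g.nabla (fun y ↦ g.nabla W y (V y)) x (U x)) (Z x)
        + g.val x (g.nabla W x (V x)) (g.nabla Z x (U x))) := by
    have e : (fun y ↦ dir (g.pair Z W) y (V y)) =ᶠ[𝓝 x]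
        fun y ↦ g.pair (fun y ↦ g.nabla Z y (V y)) W y
          + g.pair (fun y ↦ g.nabla W y (V y)) Z y := by
      filter_upwards [hV.eventually_diffAt, hZ.eventually_diffAt, hW.eventually_diffAt]
        with y h1 h2 h3
      rw [g.dir_pair h1 h2 h3, g.symm y (Z y)]
      rfl
    have nZ := g.smoothAt_nabla hV hZ
    have nW := g.smoothAt_nabla hV hW
    rw [dir_congr e, dir_add (g.pair_smoothFunAt nZ hW).diffFunAt
      (g.pair_smoothFunAt nW hZ).diffFunAt, g.dir_pair hU.diffAt nZ.diffAt hW.diffAt,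
      g.dir_pair hU.diffAt nW.diffAt hZ.diffAt]
  have h1 := g.dir_br (g.pair_smoothFunAt hZ hW) hX hY
  have h2 := g.dir_pair (hX.br hY).diffAt hZ.diffAt hW.diffAt
  rw [h1, second hX hY, second hY hX] at h2
  simp only [curv, map_sub, sub_apply]
  rw [g.symm x (Z x), g.symm x (g.nabla Z x (Y x)) (g.nabla W x (X x)),
    g.symm x (g.nabla Z x (X x)) (g.nabla W x (Y x))] at h2
  linarith

/-- Zero torsion, used twice, turns the second derivatives into terms ∇_{[V,T]} U, which cancel
against the bracket terms of the curvature, plus double brackets, which cancel by the Jacobi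
identity. -/
theorem curv_cyclic (hX : SmoothAt X x) (hY : SmoothAt Y x) (hZ : SmoothAt Z x) :
    g.curv X Y Z x + g.curv Y Z X x + g.curv Z X Y x = 0 := by
  have aux {U V T : VField d M} (hU : SmoothAt U x) (hV : SmoothAt V x) (hT : SmoothAt T x) :
      g.nabla (fun y ↦ g.nabla T y (V y)) x (U x) - g.nabla (fun y ↦ g.nabla V y (T y)) x (U x)
        = g.nabla U x (br V T x) + br U (br V T) x := by
    have n1 := g.smoothAt_nabla hV hT
    have n2 := g.smoothAt_nabla hT hV
    have n3 := hV.br hT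
    have e : (fun y ↦ g.nabla T y (V y)) =ᶠ[𝓝 x] (fun y ↦ g.nabla V y (T y)) + br V T := by
      filter_upwards [hV.eventually_diffAt, hT.eventually_diffAt] with y h1 h2
      change _ = g.nabla V y (T y) + br V T y
      rw [← g.nabla_sub_nabla h1 h2, add_sub_cancel]
    rw [g.nabla_congr n1.diffAt (n2.add n3).diffAt e, g.nabla_add n2.diffAt n3.diffAt,
      ← g.nabla_sub_nabla hU.diffAt n3.diffAt]
    abel
  have h1 := aux hX hY hZ
  have h2 := aux hY hZ hX
  have h3 := aux hZ hX hY
  have hj := jacobi hX hY hZ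
  rw [br_swap (br X Y) Z] at hj
  have hj' : br Y (br X Z) x = -br Y (br Z X) x := by
    have e : br X Z = (fun _ : M ↦ (-1 : ℝ)) • br Z X := by
      funext y; simp [br_swap X Z]
    rw [e, br_smul_right mdifferentiableAt_const (hZ.br hX).diffAt, dir_const]
    simp
  rw [hj'] at hj
  simp only [curv]
  have hs : br X (br Y Z) x + br Y (br Z X) x + br Z (br X Y) x = 0 := by
    rw [hj]; abel
  rw [← hs]
  have e1 := eq_sub_of_add_eq' h1.symm
  have e2 := eq_sub_of_add_eq' h2.symm
  have e3 := eq_sub_of_add_eq' h3.symm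
  rw [e1, e2, e3]
  abel

/-- The usual octahedron argument: four cyclic identities are combined, and the antisymmetries in
each pair cancel all but two kinds of term. -/
theorem val_curv_pair (hX : SmoothAt X x) (hY : SmoothAt Y x) (hZ : SmoothAt Z x)
    (hW : SmoothAt W x) :
    g.val x (g.curv X Y Z x) (W x) = g.val x (g.curv Z W X x) (Y x) := by
  have b {P Q R S : VField d M} (hP : SmoothAt P x) (hQ : SmoothAt Q x) (hR : SmoothAt R x) :
      g.val x (g.curv P Q R x) (S x) + g.val x (g.curv Q R P x) (S x)
        + g.val x (g.curv R P Q x) (S x) = 0 := by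
    rw [← add_apply, ← add_apply, ← map_add, ← map_add, g.curv_cyclic hP hQ hR]
    simp
  have s {P Q R S : VField d M} (hR : SmoothAt R x) :
      g.val x (g.curv Q P R x) (S x) = -g.val x (g.curv P Q R x) (S x) := by
    rw [g.curv_swap hR.diffAt]
    simp
  have a {P Q R S : VField d M} (hP : SmoothAt P x) (hQ : SmoothAt Q x) (hR : SmoothAt R x)
      (hS : SmoothAt S x) := g.val_curv_antisymm hP hQ hR hS
  have b1 := b (S := W) hX hY hZ
  have b2 := b (S := X) hY hZ hW
  have b3 := b (S := Y) hZ hW hX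
  have b4 := b (S := Z) hW hX hY
  have a1 := a hX hY hZ hW
  have a2 := a hY hZ hX hW
  have a3 := a hZ hX hY hW
  have a4 := a hZ hW hX hY
  have a5 := a hW hY hZ hX
  have a6 := a hW hX hZ hY
  have s1 := s (P := X) (Q := Z) (R := W) (S := Y) hW
  have s2 := s (P := W) (Q := Y) (R := Z) (S := X) hZ
  have s3 := s (P := W) (Q := Y) (R := X) (S := Z) hX
  have s4 := s (P := X) (Q := Z) (R := Y) (S := W) hY
  linarith

/-- Tensoriality without any Leibniz computation: in g(R(X,Y)Z, W) the field W visibly enters only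
through its value at `x`, and the symmetries move each of the other fields into that slot. -/
theorem val_curv_congr (hX : SmoothAt X x) (hX' : SmoothAt X' x) (hY : SmoothAt Y x)
    (hY' : SmoothAt Y' x) (hZ : SmoothAt Z x) (hZ' : SmoothAt Z' x) (hW : SmoothAt W x)
    (eX : X x = X' x) (eY : Y x = Y' x) (eZ : Z x = Z' x) :
    g.val x (g.curv X Y Z x) (W x) = g.val x (g.curv X' Y' Z' x) (W x) := by
  rw [g.val_curv_antisymm hX hY hZ hW, eZ, ← g.val_curv_antisymm hX hY hZ' hW,
    g.val_curv_pair hX hY hZ' hW, eY, g.val_curv_antisymm hZ' hW hX hY', eX,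
    ← g.val_curv_antisymm hZ' hW hX' hY', g.val_curv_pair hZ' hW hX' hY']

/-- The Riemann tensor can be computed with any smooth extensions of the vectors. -/
theorem riem_eq (hX : SmoothAt X x) (hY : SmoothAt Y x) (hZ : SmoothAt Z x)
    (w : TangentSpace (𝓡 d) x) :
    g.riem x (X x) (Y x) w (Z x) = g.val x (g.curv X Y Z x) w := by
  have h := g.val_curv_congr (smoothAt_ext (X x)) hX (smoothAt_ext (Y x)) hY
    (smoothAt_ext (Z x)) hZ (smoothAt_ext w) (ext_self _) (ext_self _) (ext_self _)
  rwa [ext_self] at h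

end fields

section tensor

variable {x : M} (u u' v v' w w' z z' : TangentSpace (𝓡 d) x)

theorem riem_swap_left : g.riem x v u w z = -g.riem x u v w z := by
  simp only [riem]
  rw [g.curv_swap (diffAt_ext z)]
  simp

theorem riem_swap_right : g.riem x u v z w = -g.riem x u v w z := by
  have h := g.val_curv_antisymm (smoothAt_ext u) (smoothAt_ext v) (smoothAt_ext w)
    (smoothAt_ext z)
  simp only [ext_self] at h
  exact h

theorem riem_pair : g.riem x u v w z = g.riem x w z u v := by
  have h := g.val_curv_pair (smoothAt_ext u) (smoothAt_ext v) (smoothAt_ext z)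
    (smoothAt_ext w)
  simp only [ext_self] at h
  change g.riem x u v w z = g.riem x z w v u at h
  rw [h, riem_swap_left, riem_swap_right, neg_neg]

/-- The third argument is paired with the curvature vector by the metric, so linearity is immediate
there; the symmetries carry it to the other slots. -/
theorem riem_add_third : g.riem x u v (w + w') z = g.riem x u v w z + g.riem x u v w' z := by
  simp [riem]

theorem riem_smul_third (c : ℝ) : g.riem x u v (c • w) z = c * g.riem x u v w z := by
  simp [riem]

/-- The Riemann tensor as a bilinear form in its second and fourth arguments. -/
noncomputable def riemBilin (u v : TangentSpace (𝓡 d) x) :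
    TangentSpace (𝓡 d) x →ₗ[ℝ] TangentSpace (𝓡 d) x →ₗ[ℝ] ℝ :=
  LinearMap.mk₂ ℝ (fun a b ↦ g.riem x u a v b)
    (fun a a' b ↦ by
      rw [riem_pair, riem_swap_right, riem_add_third, g.riem_pair u a, g.riem_pair u a',
        g.riem_swap_right _ _ a, g.riem_swap_right _ _ a']
      ring)
    (fun c a b ↦ by
      rw [riem_pair, riem_swap_right, riem_smul_third, g.riem_pair u a,
        g.riem_swap_right _ _ a, smul_eq_mul]
      ring)
    (fun a b b' ↦ by
      rw [riem_swap_right, riem_add_third, g.riem_swap_right _ _ b, g.riem_swap_right _ _ b']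
      ring)
    (fun c a b ↦ by
      rw [riem_swap_right, riem_smul_third, g.riem_swap_right _ _ b, smul_eq_mul]
      ring)

end tensor

end LorentzMetric
end

/-! ### Null frames: traces and existence. -/

namespace FrameIndex

variable {d : ℕ}

/-- The null and spatial indices, as an iterated option type. -/
def equivOption (d : ℕ) : Option (Option (Fin (d - 2))) ≃ FrameIndex d where
  toFun
    | none => zero
    | some none => one
    | some (some i) => space i
  invFun
    | zero => none
    | one => some none
    | space i => some (some i)
  left_inv := by rintro (_ | _ | _) <;> rfl
  right_inv := by rintro (_ | _ | _) <;> rfl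

instance : Fintype (FrameIndex d) := .ofEquiv _ (equivOption d)

instance : DecidableEq (FrameIndex d) := (equivOption d).symm.decidableEq

theorem card (hd : 2 ≤ d) : Fintype.card (FrameIndex d) = d := by
  rw [← Fintype.card_congr (equivOption d)]
  simp
  omega

theorem sum_eq {A : Type*} [AddCommMonoid A] (f : FrameIndex d → A) :
    ∑ a, f a = f zero + (f one + ∑ i, f (space i)) := by
  rw [← (equivOption d).sum_comp, Fintype.sum_option, Fintype.sum_option]
  rfl

theorem eta_mul_eta :
    (Matrix.of eta : Matrix (FrameIndex d) (FrameIndex d) ℝ) * Matrix.of eta = 1 := by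
  ext a b
  rw [Matrix.mul_apply, sum_eq, Matrix.one_apply]
  cases a <;> cases b <;> simp [eta]

end FrameIndex

section

variable {d : ℕ} {M : Type*} [TopologicalSpace M] [ChartedSpace (EuclideanSpace ℝ (Fin d)) M]
variable [IsManifold (𝓡 d) ∞ M]

namespace LorentzMetric

variable {g : LorentzMetric d M}

namespace NullFrame

variable {x : M} (e : g.NullFrame x)

theorem gram_eq : g.gram e.vec = Matrix.of FrameIndex.eta := by
  ext a b
  exact e.inner_eq a b

theorem det_gram_ne_zero : (g.gram e.vec).det ≠ 0 := by
  intro h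
  have := congrArg Matrix.det (FrameIndex.eta_mul_eta (d := d))
  rw [Matrix.det_mul, ← e.gram_eq, h] at this
  simp at this

theorem gram_inv : (g.gram e.vec)⁻¹ = Matrix.of FrameIndex.eta := by
  rw [gram_eq]
  exact Matrix.inv_eq_left_inv FrameIndex.eta_mul_eta

/-- The expansion of a vector in a null frame. -/
theorem expand (hd : 2 ≤ d) (v : TangentSpace (𝓡 d) x) :
    v = g.val x v (e.vec .one) • e.vec .zero + g.val x v (e.vec .zero) • e.vec .one
      + ∑ i, g.val x v (e.vec (.space i)) • e.vec (.space i) := by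
  conv_lhs => rw [← g.sum_inv_gram (FrameIndex.card hd) e.det_gram_ne_zero v]
  simp [e.gram_inv, FrameIndex.sum_eq, FrameIndex.eta]
  abel

/-- The trace of a bilinear form in a null frame. -/
theorem trace_eq (hd : 2 ≤ d) (B : TangentSpace (𝓡 d) x →ₗ[ℝ] TangentSpace (𝓡 d) x →ₗ[ℝ] ℝ) :
    ∑ i, ∑ j, g.inv x i j * B (coordVec x i) (coordVec x j) =
      B (e.vec .zero) (e.vec .one) + B (e.vec .one) (e.vec .zero)
        + ∑ i, B (e.vec (.space i)) (e.vec (.space i)) := by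
  rw [g.sum_inv_bilin (FrameIndex.card hd) e.det_gram_ne_zero]
  simp [e.gram_inv, FrameIndex.sum_eq, FrameIndex.eta]
  ring

end NullFrame

/-- Every null vector is the first vector of a null frame. -/
theorem exists_nullFrame (g : LorentzMetric d M) (hd : 2 ≤ d) {x : M}
    {l : TangentSpace (𝓡 d) x} (hl : l ≠ 0) (hnull : g.val x l l = 0) :
    ∃ e : g.NullFrame x, e.vec .zero = l := by
  obtain ⟨b, hb⟩ := g.signature x
  obtain ⟨n, rfl⟩ : ∃ n, d = n + 2 := ⟨d - 2, by omega⟩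
  let S (y : EuclideanSpace ℝ (Fin (n + 1))) : TangentSpace (𝓡 (n + 2)) x :=
    ∑ i, y i • b i.succ
  have hSS (y z) : g.val x (S y) (S z) = inner ℝ y z := by
    simp only [S, map_sum, map_smul, sum_apply, smul_apply, hb, PiLp.inner_apply]
    simp [mul_comm]
  have hS0 (y) : g.val x (b 0) (S y) = 0 := by
    simp only [S, map_sum, map_smul, hb]
    exact Finset.sum_eq_zero fun i _ ↦ by simp [(Fin.succ_ne_zero i).symm]
  have h00 : g.val x (b 0) (b 0) = -1 := by simp [hb]
  let a := b.repr l 0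
  let s : EuclideanSpace ℝ (Fin (n + 1)) := WithLp.toLp 2 fun i ↦ b.repr l i.succ
  have hdec : l = a • b 0 + S s := by
    conv_lhs => rw [← b.sum_repr l, Fin.sum_univ_succ]
  have hbil (p q : ℝ) (y z) : g.val x (p • b 0 + S y) (q • b 0 + S z) = -(p * q) + inner ℝ y z := by
    simp only [map_add, map_smul, add_apply, smul_apply, smul_eq_mul, hSS, hS0, h00,
      g.symm x (S y) (b 0)]
    ring
  have has : a * a = inner ℝ s s := by
    rw [hdec, hbil] at hnull
    linarith
  have hs : s ≠ 0 := by
    intro h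
    rw [h, inner_zero_left] at has
    refine hl ?_
    rw [hdec, mul_self_eq_zero.1 has, h]
    simp [S]
  have ha : a ≠ 0 := by
    rintro h
    rw [h, mul_zero] at has
    exact hs (inner_self_eq_zero.1 has.symm)
  have hfin : Fact (Module.finrank ℝ (EuclideanSpace ℝ (Fin (n + 1))) = n + 1) := ⟨by simp⟩
  have hrank : Module.finrank ℝ ((ℝ ∙ s)ᗮ : Submodule ℝ (EuclideanSpace ℝ (Fin (n + 1)))) = n :=
    Submodule.finrank_orthogonal_span_singleton hs
  let o := (stdOrthonormalBasis ℝ ((ℝ ∙ s)ᗮ)).reindex (finCongr hrank)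
  have hos (i) : inner ℝ s (o i : EuclideanSpace ℝ (Fin (n + 1))) = 0 :=
    Submodule.mem_orthogonal_singleton_iff_inner_right.1 (o i).2
  have hoo (i j) : inner ℝ (o i : EuclideanSpace ℝ (Fin (n + 1))) (o j) = if i = j then 1 else 0 := by
    rw [← Submodule.coe_inner]
    exact orthonormal_iff_ite.1 o.orthonormal i j
  -- The vector n is l with its time component reversed, scaled by `c`; then l · n = c(a² + |s|²) =
  -- 2ca², which fixes `c`. The m_i form an orthonormal basis of the orthogonal complement of `s` in
  -- the spacelike part.
  let c := (2 * (a * a))⁻¹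
  have hSm (c : ℝ) (y) : S (c • y) = c • S y := by simp [S, Finset.smul_sum, smul_smul]
  have hm (y) : S y = (0 : ℝ) • b 0 + S y := by simp
  let vec : FrameIndex (n + 2) → TangentSpace (𝓡 (n + 2)) x
    | .zero => a • b 0 + S s
    | .one => (-(c * a)) • b 0 + S (c • s)
    | .space i => (0 : ℝ) • b 0 + S (o i)
  refine ⟨⟨vec, ?_⟩, hdec.symm⟩
  have hc : c * (2 * (a * a)) = 1 := inv_mul_cancel₀ (by positivity)
  intro p q
  cases p <;> cases q <;>
    simp only [vec, hbil, FrameIndex.eta, inner_smul_left, inner_smul_right, ← has, hos, hoo,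
      real_inner_comm s, conj_trivial]
  all_goals first | (simp; done) | (ring_nf; done) | linear_combination hc

end LorentzMetric
end

/-! ### Geometry of a Kundt congruence: ℓ^⊥ and the curvature. -/

section

variable {d : ℕ} {M : Type*} [TopologicalSpace M] [ChartedSpace (EuclideanSpace ℝ (Fin d)) M]
variable [IsManifold (𝓡 d) ∞ M]

namespace LorentzMetric

variable {g : LorentzMetric d M} {ℓ : VField d M}

/-- The bilinear form `g(∇_a Y, b)`. -/
noncomputable def nablaBilin (g : LorentzMetric d M) {Y : VField d M} {x : M} (hY : DiffAt Y x) :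
    TangentSpace (𝓡 d) x →ₗ[ℝ] TangentSpace (𝓡 d) x →ₗ[ℝ] ℝ :=
  LinearMap.mk₂ ℝ (fun a b ↦ g.val x (g.nabla Y x a) b)
    (fun a a' b ↦ by simp [g.nabla_add_vec hY]) (fun c a b ↦ by simp [g.nabla_smul_vec hY])
    (fun a b b' ↦ by simp) (fun c a b ↦ by simp)

/-- A vector orthogonal to the null vector `ℓ` and to the spatial part of a null frame containing
`ℓ` is proportional to `ℓ`. -/
theorem NullFrame.eq_smul {x : M} (e : g.NullFrame x) (hd : 2 ≤ d) {q : TangentSpace (𝓡 d) x}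
    (h0 : g.val x q (e.vec .zero) = 0) (hi : ∀ i, g.val x q (e.vec (.space i)) = 0) :
    q = g.val x q (e.vec .one) • e.vec .zero := by
  conv_lhs => rw [e.expand hd q]
  simp [h0, hi]

/-- A vector orthogonal to a null vector field extends to a local field with the same property. -/
theorem exists_orthogonal_extension (hs : IsSmoothField ℓ) (hnull : g.IsNullField ℓ) {x : M}
    {u : TangentSpace (𝓡 d) x} (hu : g.val x u (ℓ x) = 0) :
    ∃ U : VField d M, SmoothAt U x ∧ U x = u ∧ g.pair U ℓ =ᶠ[𝓝 x] fun _ ↦ 0 := by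
  obtain ⟨n, hn⟩ := g.exists_val_ne_zero (hnull x).1
  rw [g.symm] at hn
  have hN : SmoothAt (ext n) x := smoothAt_ext n
  have hE : SmoothAt (ext u) x := smoothAt_ext u
  have hp := g.pair_smoothFunAt hN (hs x)
  have hp0 : g.pair (ext n) ℓ x ≠ 0 := by rwa [pair, ext_self]
  -- Subtracting this multiple of `ext n` projects `ext u` onto ℓ^⊥ near `x`. The factor vanishes at
  -- `x`, so the value `u` is kept.
  let f : M → ℝ := fun y ↦ g.pair (ext u) ℓ y / g.pair (ext n) ℓ y
  have hf : SmoothFunAt d f x := ContMDiffAt.div₀ (g.pair_smoothFunAt hE (hs x)) hp hp0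
  refine ⟨ext u - f • ext n, hE.sub (hN.smul hf), ?_, ?_⟩
  · have : f x = 0 := by simp [f, pair, ext_self, hu]
    simp [this, ext_self]
  · filter_upwards [hp.continuousAt.eventually_ne hp0] with y hy
    have : g.pair (ext u - f • ext n) ℓ y = g.pair (ext u) ℓ y - f y * g.pair (ext n) ℓ y := by
      simp [pair]
    rw [this, div_mul_cancel₀ _ hy, sub_self]

namespace IsKundtCongruence

theorem smoothAt (hℓ : g.IsKundtCongruence ℓ) (x : M) : SmoothAt ℓ x := hℓ.smooth x

theorem val_nabla_self (hℓ : g.IsKundtCongruence ℓ) (x : M) (v : TangentSpace (𝓡 d) x) :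
    g.val x (g.nabla ℓ x v) (ℓ x) = 0 := by
  have h := g.dir_pair (diffAt_ext v) (hℓ.smoothAt x).diffAt (hℓ.smoothAt x).diffAt
  have h0 : g.pair ℓ ℓ = fun _ ↦ 0 := funext fun y ↦ (hℓ.null y).2
  rw [h0, dir_const, g.symm x (ℓ x), ext_self] at h
  linarith

/-- With zero trace the shear is the whole symmetric part, and the twist is the antisymmetric part.
-/
theorem opticalMatrix_eq_zero (hℓ : g.IsKundtCongruence ℓ) {x : M} (e : g.NullFrame x)
    (he : e.vec .zero = ℓ x) : opticalMatrix ℓ e = 0 := by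
  have h1 := hℓ.nonexpanding x e he
  have h2 := hℓ.nonshearing x e he
  have h3 := hℓ.nontwisting x e he
  rw [shear, h1, zero_div, zero_smul, sub_zero] at h2
  rw [twist] at h3
  have h : opticalMatrix ℓ e = (1 / 2 : ℝ) • (opticalMatrix ℓ e + (opticalMatrix ℓ e)ᵀ)
      + (1 / 2 : ℝ) • (opticalMatrix ℓ e - (opticalMatrix ℓ e)ᵀ) := by
    module
  rw [h, h2, h3, add_zero]

/-- The second fundamental form of the distribution orthogonal to `ℓ` vanishes. -/
theorem val_nabla_eq_zero (hℓ : g.IsKundtCongruence ℓ) (hd : 2 ≤ d) {x : M}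
    {a b : TangentSpace (𝓡 d) x} (ha : g.val x a (ℓ x) = 0) (hb : g.val x b (ℓ x) = 0) :
    g.val x (g.nabla ℓ x a) b = 0 := by
  obtain ⟨e, he⟩ := g.exists_nullFrame hd (hℓ.null x).1 (hℓ.null x).2
  obtain ⟨c, hc⟩ := hℓ.geodesic x
  have hρ (i j) : g.nablaBilin (hℓ.smoothAt x).diffAt (e.vec (.space j)) (e.vec (.space i)) = 0 :=
    congrFun (congrFun (hℓ.opticalMatrix_eq_zero e he) i) j
  have h0 : g.nablaBilin (hℓ.smoothAt x).diffAt (ℓ x) b = 0 := by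
    change g.val x (g.nabla ℓ x (ℓ x)) b = 0
    rw [hc, map_smul, smul_apply, g.symm, hb, smul_zero]
  have h1 (v) : g.nablaBilin (hℓ.smoothAt x).diffAt v (ℓ x) = 0 := hℓ.val_nabla_self x v
  change g.nablaBilin (hℓ.smoothAt x).diffAt a b = 0
  rw [e.expand hd a, he, ha]
  simp only [map_add, map_smul, map_sum, LinearMap.add_apply, LinearMap.smul_apply,
    LinearMap.sum_apply, h0, smul_zero, zero_smul, zero_add, add_zero]
  refine Finset.sum_eq_zero fun j _ ↦ ?_
  rw [e.expand hd b, he, hb]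
  simp [h1, hρ]

/-- `∇_v ℓ` is proportional to `ℓ` for `v` orthogonal to `ℓ`. -/
theorem exists_nabla_eq_smul (hℓ : g.IsKundtCongruence ℓ) (hd : 2 ≤ d) {x : M}
    {v : TangentSpace (𝓡 d) x} (hv : g.val x v (ℓ x) = 0) : ∃ c : ℝ, g.nabla ℓ x v = c • ℓ x := by
  obtain ⟨e, he⟩ := g.exists_nullFrame hd (hℓ.null x).1 (hℓ.null x).2
  refine ⟨g.val x (g.nabla ℓ x v) (e.vec .one), ?_⟩
  conv_rhs => rw [← he]
  refine e.eq_smul hd ?_ fun i ↦ hℓ.val_nabla_eq_zero hd hv ?_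
  · rw [he, hℓ.val_nabla_self]
  · rw [← he, e.inner_eq]; rfl

/-- The Riemann tensor of a Kundt spacetime vanishes on `ℓ` and three vectors orthogonal to
`ℓ`. -/
theorem riem_eq_zero (hℓ : g.IsKundtCongruence ℓ) (hd : 2 ≤ d) {x : M}
    {u v w : TangentSpace (𝓡 d) x} (hu : g.val x u (ℓ x) = 0) (hv : g.val x v (ℓ x) = 0)
    (hw : g.val x w (ℓ x) = 0) : g.riem x u v w (ℓ x) = 0 := by
  obtain ⟨U, hU, rfl, hUℓ⟩ := g.exists_orthogonal_extension hℓ.smooth hℓ.null hu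
  obtain ⟨V, hV, rfl, hVℓ⟩ := g.exists_orthogonal_extension hℓ.smooth hℓ.null hv
  obtain ⟨W, hW, rfl, hWℓ⟩ := g.exists_orthogonal_extension hℓ.smooth hℓ.null hw
  have hs := hℓ.smoothAt x
  rw [g.riem_eq hU hV hs]
  -- Differentiating g(B, ℓ) = 0 along A gives g(∇_A B, ℓ) = -g(B, ∇_A ℓ) = 0.
  have orth {A B : VField d M} (hA : SmoothAt A x) (hB : SmoothAt B x)
      (hA0 : g.val x (A x) (ℓ x) = 0) (hBℓ : g.pair B ℓ =ᶠ[𝓝 x] fun _ ↦ 0) :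
      g.val x (g.nabla B x (A x)) (ℓ x) = 0 := by
    have h := g.dir_pair hA.diffAt hB.diffAt hs.diffAt
    rw [dir_congr hBℓ, dir_const, g.symm x (B x),
      hℓ.val_nabla_eq_zero hd hA0 hBℓ.self_of_nhds] at h
    linarith
  -- Differentiating g(∇_B ℓ, W) = 0 along A leaves -g(∇_B ℓ, ∇_A W). This vanishes because ∇_B ℓ is
  -- a multiple of `ℓ` and ∇_A W is orthogonal to `ℓ`.
  have second {A B : VField d M} (hA : SmoothAt A x) (hB : SmoothAt B x)
      (hA0 : g.val x (A x) (ℓ x) = 0) (hBℓ : g.pair B ℓ =ᶠ[𝓝 x] fun _ ↦ 0) :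
      g.val x (g.nabla (fun y ↦ g.nabla ℓ y (B y)) x (A x)) (W x) = 0 := by
    have h := g.dir_pair hA.diffAt (g.smoothAt_nabla hB hs).diffAt hW.diffAt
    have e : g.pair (fun y ↦ g.nabla ℓ y (B y)) W =ᶠ[𝓝 x] fun _ ↦ 0 := by
      filter_upwards [hBℓ, hWℓ] with y h1 h2
      exact hℓ.val_nabla_eq_zero hd h1 h2
    obtain ⟨c, hc⟩ := hℓ.exists_nabla_eq_smul hd (v := B x) hBℓ.self_of_nhds
    rw [dir_congr e, dir_const, hc, map_smul, smul_apply, g.symm x (ℓ x),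
      orth hA hW hA0 hWℓ, smul_zero, add_zero] at h
    exact h.symm
  -- Involutivity of ℓ^⊥, from zero torsion; it disposes of the term ∇_{[U,V]} ℓ.
  have hbr : g.val x (br U V x) (ℓ x) = 0 := by
    rw [← g.nabla_sub_nabla hU.diffAt hV.diffAt, map_sub, sub_apply, orth hU hV hu hVℓ,
      orth hV hU hv hUℓ, sub_zero]
  simp only [curv, map_sub, sub_apply]
  rw [second hU hV hu hVℓ, second hV hU hv hUℓ]
  have h3 := hℓ.val_nabla_eq_zero hd hbr hw
  rw [h3, sub_zero, sub_zero]

end IsKundtCongruence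

end LorentzMetric
end

/-! ### Ricci and Weyl components of positive boost weight. -/

section

variable {d : ℕ} {M : Type*} [TopologicalSpace M] [ChartedSpace (EuclideanSpace ℝ (Fin d)) M]
variable [IsManifold (𝓡 d) ∞ M]

namespace LorentzMetric

variable {g : LorentzMetric d M} {ℓ : VField d M} {x : M}

theorem riem_self_left (u w z : TangentSpace (𝓡 d) x) : g.riem x u u w z = 0 := by
  linarith [g.riem_swap_left u u w z]

theorem riem_self_right (u v w : TangentSpace (𝓡 d) x) : g.riem x u v w w = 0 := by
  linarith [g.riem_swap_right u v w w]

theorem riem_add_first (u u' v w z : TangentSpace (𝓡 d) x) :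
    g.riem x (u + u') v w z = g.riem x u v w z + g.riem x u' v w z := by
  rw [riem_pair, riem_add_third, g.riem_pair u, g.riem_pair u']

theorem riem_smul_first (c : ℝ) (u v w z : TangentSpace (𝓡 d) x) :
    g.riem x (c • u) v w z = c * g.riem x u v w z := by
  rw [riem_pair, riem_smul_third, g.riem_pair u]

/-- The Ricci tensor in a null frame. -/
theorem NullFrame.ric_eq (e : g.NullFrame x) (hd : 2 ≤ d) (u v : TangentSpace (𝓡 d) x) :
    g.ric x u v = g.riem x u (e.vec .zero) v (e.vec .one) + g.riem x u (e.vec .one) v (e.vec .zero)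
      + ∑ i, g.riem x u (e.vec (.space i)) v (e.vec (.space i)) :=
  e.trace_eq hd (g.riemBilin u v)

theorem NullFrame.ric_comm (e : g.NullFrame x) (hd : 2 ≤ d) (u v : TangentSpace (𝓡 d) x) :
    g.ric x u v = g.ric x v u := by
  rw [e.ric_eq hd, e.ric_eq hd v, g.riem_pair u (e.vec .zero), g.riem_pair u (e.vec .one),
    add_comm (g.riem x v _ _ _)]
  exact congrArg _ (Finset.sum_congr rfl fun i _ ↦ g.riem_pair _ _ _ _)

theorem val_ricVec (v w : TangentSpace (𝓡 d) x) : g.val x (g.ricVec x v) w = g.ric x w v := by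
  refine g.val_sharp ⟨fun a b ↦ ?_, fun c a ↦ ?_⟩ w
  · simp [ric, riem_add_first, mul_add, Finset.sum_add_distrib]
  · simp only [ric, riem_smul_first, Finset.mul_sum, smul_eq_mul]
    exact Finset.sum_congr rfl fun i _ ↦ Finset.sum_congr rfl fun j _ ↦ by ring

namespace IsKundtCongruence

/-- The Riemann components with no index `1` and at least one index `0` vanish. -/
theorem riem_frame (hℓ : g.IsKundtCongruence ℓ) (hd : 2 ≤ d) {e : g.NullFrame x}
    (he : e.vec .zero = ℓ x) {i j k : FrameIndex d} (hi : i ≠ .one) (hj : j ≠ .one)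
    (hk : k ≠ .one) :
    g.riem x (e.vec i) (e.vec j) (e.vec k) (e.vec .zero) = 0 ∧
    g.riem x (e.vec i) (e.vec j) (e.vec .zero) (e.vec k) = 0 ∧
    g.riem x (e.vec k) (e.vec .zero) (e.vec i) (e.vec j) = 0 ∧
    g.riem x (e.vec .zero) (e.vec k) (e.vec i) (e.vec j) = 0 := by
  have h0 {a : FrameIndex d} (ha : a ≠ .one) : g.val x (e.vec a) (ℓ x) = 0 := by
    rw [← he, e.inner_eq]
    cases a <;> simp_all [FrameIndex.eta]
  have h : g.riem x (e.vec i) (e.vec j) (e.vec k) (e.vec .zero) = 0 := by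
    rw [he]
    exact hℓ.riem_eq_zero hd (h0 hi) (h0 hj) (h0 hk)
  have h' : g.riem x (e.vec i) (e.vec j) (e.vec .zero) (e.vec k) = 0 := by
    rw [riem_swap_right, h, neg_zero]
  exact ⟨h, h', (g.riem_pair _ _ _ _).trans h, (g.riem_pair _ _ _ _).trans h'⟩

theorem ric_zero_zero (hℓ : g.IsKundtCongruence ℓ) (hd : 2 ≤ d) {e : g.NullFrame x}
    (he : e.vec .zero = ℓ x) : g.ric x (e.vec .zero) (e.vec .zero) = 0 := by
  rw [e.ric_eq hd, riem_self_left, riem_self_right]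
  simp [(hℓ.riem_frame hd he (i := .zero) (j := .space _) (k := .space _) (by simp) (by simp)
    (by simp)).2.1]

/-- The Ricci components of boost weight `1` are, up to sign, Riemann components. -/
theorem ric_space_zero (hℓ : g.IsKundtCongruence ℓ) (hd : 2 ≤ d) {e : g.NullFrame x}
    (he : e.vec .zero = ℓ x) (i : Fin (d - 2)) :
    g.ric x (e.vec (.space i)) (e.vec .zero) =
      g.riem x (e.vec (.space i)) (e.vec .zero) (e.vec .zero) (e.vec .one) := by
  rw [e.ric_eq hd, riem_self_right]
  simp [(hℓ.riem_frame hd he (i := .space _) (j := .space _) (k := .space _) (by simp) (by simp)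
    (by simp)).2.1]

/-- The essential component is C_{0i0j}, which differs from R_{0i0j} = 0 only by a multiple of
Ric_{00} δ_{ij}, as g_{00} = g_{0i} = 0. -/
theorem weyl_two (hℓ : g.IsKundtCongruence ℓ) (hd : 2 ≤ d) : g.WeylBoostVanishes ℓ 2 := by
  intro x e he i j k l h
  have r00 := hℓ.ric_zero_zero hd he
  have R {i j k : FrameIndex d} := hℓ.riem_frame hd he (i := i) (j := j) (k := k)
  cases i <;> cases j <;> cases k <;> cases l <;>
    simp [FrameIndex.boostWeight] at h <;>
    simp [weyl, e.inner_eq, FrameIndex.eta, r00, riem_self_left, riem_self_right, R]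

/-- As Ric_{00} = 0, R(ℓ) has no component along n. Its norm is then the sum of the Ric_{i0}², which
vanishes only if every term does. -/
theorem ric_space_zero_eq_zero (hℓ : g.IsKundtCongruence ℓ) (hd : 2 ≤ d) {e : g.NullFrame x}
    (he : e.vec .zero = ℓ x) (hric : g.val x (g.ricVec x (ℓ x)) (g.ricVec x (ℓ x)) = 0)
    (i : Fin (d - 2)) : g.ric x (e.vec (.space i)) (e.vec .zero) = 0 := by
  rw [← he] at hric
  rw [e.expand hd (g.ricVec x (e.vec .zero))] at hric
  simp only [val_ricVec, hℓ.ric_zero_zero hd he, zero_smul, add_zero] at hric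
  simp only [map_add, map_sum, map_smul, add_apply, smul_apply, sum_apply, e.inner_eq,
    FrameIndex.eta] at hric
  simp only [smul_eq_mul, mul_zero, Finset.sum_const_zero, add_zero, zero_add, mul_ite, mul_one,
    Finset.sum_ite_eq', Finset.mem_univ, if_true] at hric
  have h := (Finset.sum_eq_zero_iff_of_nonneg fun j _ ↦ mul_self_nonneg _).1 hric i
    (Finset.mem_univ i)
  exact mul_self_eq_zero.1 h

/-- The essential components are C_{0ijk} and C_{010i}. Their Riemann parts vanish, and their trace
parts involve only Ric_{00} and Ric_{0i}. -/
theorem weyl_one (hℓ : g.IsKundtCongruence ℓ) (hd : 2 ≤ d)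
    (hric : ∀ x : M, g.val x (g.ricVec x (ℓ x)) (g.ricVec x (ℓ x)) = 0) :
    g.WeylBoostVanishes ℓ 1 := by
  intro x e he i j k l h
  have r00 := hℓ.ric_zero_zero hd he
  have r0 := hℓ.ric_space_zero_eq_zero hd he (hric x)
  have r0' (i) := (e.ric_comm hd (e.vec .zero) (e.vec (.space i))).trans (r0 i)
  have R {i j k : FrameIndex d} := hℓ.riem_frame hd he (i := i) (j := j) (k := k)
  -- R_{i001} = Ric_{i0} = 0; the facts below are its images under the Riemann symmetries, one for
  -- each index order met in the case split.
  have q1 (i) := (hℓ.ric_space_zero hd he i).symm.trans (r0 i)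
  have q2 (i) : g.riem x (e.vec .zero) (e.vec (.space i)) (e.vec .zero) (e.vec .one) = 0 := by
    rw [riem_swap_left, q1, neg_zero]
  have q3 (i) : g.riem x (e.vec (.space i)) (e.vec .zero) (e.vec .one) (e.vec .zero) = 0 := by
    rw [riem_swap_right, q1, neg_zero]
  have q4 (i) : g.riem x (e.vec .zero) (e.vec (.space i)) (e.vec .one) (e.vec .zero) = 0 := by
    rw [riem_swap_right, q2, neg_zero]
  have p1 (i) := (g.riem_pair _ _ _ _).trans (q1 i)
  have p2 (i) := (g.riem_pair _ _ _ _).trans (q2 i)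
  have p3 (i) := (g.riem_pair _ _ _ _).trans (q3 i)
  have p4 (i) := (g.riem_pair _ _ _ _).trans (q4 i)
  cases i <;> cases j <;> cases k <;> cases l <;>
    simp [FrameIndex.boostWeight] at h <;>
    simp [weyl, e.inner_eq, FrameIndex.eta, r00, r0, r0', riem_self_left, riem_self_right, R,
      q1, q2, q3, q4, p1, p2, p3, p4]

end IsKundtCongruence

end LorentzMetric
end
end Kundt

theorem mainTheorem7 (d : ℕ) (hd : 4 ≤ d) (M : Type*) [TopologicalSpace M] [T2Space M]
    [ChartedSpace (EuclideanSpace ℝ (Fin d)) M] [IsManifold (𝓡 d) ∞ M]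
    (g : Kundt.LorentzMetric d M) (ℓ : Kundt.VField d M) (hℓ : g.IsKundtCongruence ℓ) :
    g.IsWAND ℓ ∧
      ((∀ x : M, g.val x (g.ricVec x (ℓ x)) (g.ricVec x (ℓ x)) = 0) →
        g.IsMultipleWAND ℓ ∧ g.IsAlgebraicallySpecial) := by
  have hd2 : 2 ≤ d := by omega
  have h2 := hℓ.weyl_two hd2
  refine ⟨⟨hℓ.smooth, hℓ.null, h2⟩, fun hric ↦ ?_⟩
  have h : g.IsMultipleWAND ℓ := ⟨hℓ.smooth, hℓ.null, h2, hℓ.weyl_one hd2 hric⟩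
  exact ⟨h, ℓ, h⟩
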